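/- For a permutation $\pi$ of $\{1,\dots,n\}$ and a pattern $\tau\in S_m$, an occurrence of $\tau$ in $\pi$ is a choice of indices $1\le i_1<\dots<i_m\le n$ such that $(\pi(i_1),\dots,\pi(i_m))$ is order-isomorphic to $\tau$; let $21(\pi)$ be the number of occurrences of the pattern $21$ in $\pi$. For $r\ge 0$ let $$N_r(x)=\sum_{n\ge 0}\ \sum_{\pi}(-1)^{21(\pi)}\,x^n\in\mathbb{Q}[[x]],$$ where the inner sum runs over all involutions $\pi=\pi^{-1}$ of $\{1,\dots,n\}$ that contain exactly $r$ occurrences of the pattern $3412$ (the empty permutation being the only involution for $n=0$). Let $s=\sqrt{1-2x+5x^2}\in\mathbb{Q}[[x]]$ be the formal power series with constant term $1$ and $s^2=1-2x+5x^2$. Then for every $r\ge 0$ the series $N_r(x)$ is a rational function in $x$ and $\sqrt{1-2x+5x^2}$; that is, there are polynomials $P,Q\in\mathbb{Q}[u,v]$ such that $Q(x,s)\neq 0$ and $Q(x,s)\,N_r(x)=P(x,s)$ in $\mathbb{Q}[[x]]$. -/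

import Mathlib

/-- The number of occurrences of the pattern `τ` (written as a word with distinct letters) in the
permutation `π`: the number of increasing index sequences `i` such that the subsequence
`π (i 0), …, π (i (m-1))` is order-isomorphic to `τ`. -/
def occurrences {m n : ℕ} (τ : Fin m → ℕ) (π : Equiv.Perm (Fin n)) : ℕ :=
  (Finset.univ.filter fun i : Fin m → Fin n =>
    StrictMono i ∧ ∀ a b : Fin m, π (i a) < π (i b) ↔ τ a < τ b).card

/-- The involutions on `n` letters that contain the pattern `3412` exactly `r` times. -/
def involutions3412 (r n : ℕ) : Finset (Equiv.Perm (Fin n)) :=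
  Finset.univ.filter fun π => π⁻¹ = π ∧ occurrences ![3, 4, 1, 2] π = r

/-- The signed generating function `N_r(x)`: the coefficient of `x ^ n` is the sum of
`(-1) ^ 21(π)` over the involutions `π` on `n` letters with exactly `r` occurrences of `3412`,
where `21(π)` is the number of occurrences of `21` in `π`. -/
def signedGF (r : ℕ) : PowerSeries ℚ :=
  PowerSeries.mk fun n => ∑ π ∈ involutions3412 r n, (-1 : ℚ) ^ occurrences ![2, 1] π

/-! Sign. On the inversions of an involution `π` the map `(i, j) ↦ (π j, π i)` is an involution
whose fixed points are the two-cycles. Hence the sign is `(-1)` to the number of two-cycles, and it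
multiplies when a fixed point is inflated by another involution.

Decomposition. Positions start at 0. Collapse the longest invariant interval starting at position 1
(possibly empty) to a fixed point, then do the same at 3, 5, … until the points run out. Thus every
involution arises uniquely from a core of some size `2j`, with 1, 3, …, `2j - 1` fixed, by inflating
these `j` points by arbitrary involutions (`infl_bijOn`). Maximality of the intervals puts every
even point of the core, except 0 and its partner, on a crossing arc. Each crossing is an occurrence
of 3412, so for given `r` there are finitely many cores (`Stage.le_crossings`). At most two marked
points occur without crossings: the cores are then the empty one, `idTwo` and `arcPoint`.

Induction. A crossing pair of arcs over an inflated point turns each 12 of the block into a 3412.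
The claim is therefore proved for all statistics `stat D`, that is 3412 plus `D` times 12, by strong
induction on the value `r` simultaneously for all `D`; `stat_infl` is the transformation law. A core
with a crossing costs at least 1, so its blocks involve only smaller values (`gf_inflAll_mem`). What
remains is the equation from the crossing-free cores (`statGF_eq`). With `F = statGF 0 0` it reads
`F = 1 + xF - x²F²`, and `s = 1 - x + 2x²F` is the root of its discriminant. For `D = 0`, `r > 0` it
is linear in the unknown series with coefficient `s`, up to a power of `x`; for `D > 0` the
coefficient is `1 + x²`. -/

/-! ### Power series rational in `x` and `s` -/

/-- The power series that are rational functions of `X` and `s`. -/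
noncomputable def ratSubalgebra (s : PowerSeries ℚ) : Subalgebra ℚ (PowerSeries ℚ) where
  carrier := {f | ∃ P Q : MvPolynomial (Fin 2) ℚ,
    MvPolynomial.aeval ![PowerSeries.X, s] Q ≠ 0 ∧
    MvPolynomial.aeval ![PowerSeries.X, s] Q * f = MvPolynomial.aeval ![PowerSeries.X, s] P}
  mul_mem' := by
    rintro f g ⟨P, Q, hQ, h⟩ ⟨P', Q', hQ', h'⟩
    refine ⟨P * P', Q * Q', ?_, ?_⟩
    · rw [map_mul]; exact mul_ne_zero hQ hQ'
    · rw [map_mul, map_mul, ← h, ← h']; ring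
  add_mem' := by
    rintro f g ⟨P, Q, hQ, h⟩ ⟨P', Q', hQ', h'⟩
    refine ⟨P * Q' + P' * Q, Q * Q', ?_, ?_⟩
    · rw [map_mul]; exact mul_ne_zero hQ hQ'
    · rw [map_mul, map_add, map_mul, map_mul, ← h, ← h']; ring
  algebraMap_mem' := by
    intro q
    refine ⟨MvPolynomial.C q, 1, by simp, ?_⟩
    rw [map_one, one_mul, MvPolynomial.aeval_C]

namespace ratSubalgebra

variable {s : PowerSeries ℚ}

theorem X_mem : (PowerSeries.X : PowerSeries ℚ) ∈ ratSubalgebra s :=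
  ⟨MvPolynomial.X 0, 1, by simp, by simp⟩

theorem self_mem : s ∈ ratSubalgebra s :=
  ⟨MvPolynomial.X 1, 1, by simp, by simp⟩

/-- The subalgebra is closed under those divisions that exist among power series; this is how the
functional equations are solved inside it. -/
theorem of_mul_mem {f g : PowerSeries ℚ} (hg : g ≠ 0) (hgm : g ∈ ratSubalgebra s)
    (h : g * f ∈ ratSubalgebra s) : f ∈ ratSubalgebra s := by
  obtain ⟨P, Q, hQ, e⟩ := hgm
  obtain ⟨P', Q', hQ', e'⟩ := h
  refine ⟨P' * Q, Q' * P, ?_, ?_⟩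
  · rw [map_mul, ← e]
    exact mul_ne_zero hQ' (mul_ne_zero hQ hg)
  · rw [map_mul, map_mul, ← e, ← e']; ring

end ratSubalgebra

/-! ### Weighted generating functions -/

/-- A type with a size and a weight, such that there are finitely many elements of each size. -/
class Graded (α : Type) where
  size : α → ℕ
  wt : α → ℚ
  finite_fiber : ∀ n, {a | size a = n}.Finite

namespace Graded

open Classical in
/-- The weighted generating function of a set. -/
noncomputable def gf {α : Type} [Graded α] (S : Set α) : PowerSeries ℚ :=
  PowerSeries.mk fun n => ∑ a ∈ (finite_fiber (α := α) n).toFinset with a ∈ S, wt a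

instance : Graded Unit where
  size _ := 0
  wt _ := 1
  finite_fiber _ := Set.toFinite _

instance {α β : Type} [Graded α] [Graded β] : Graded (α × β) where
  size x := size x.1 + size x.2
  wt x := wt x.1 * wt x.2
  finite_fiber n := by
    refine Set.Finite.subset (Set.Finite.biUnion (Finset.HasAntidiagonal.antidiagonal n).finite_toSet
      fun p _ => (finite_fiber (α := α) p.1).prod (finite_fiber (α := β) p.2)) ?_
    rintro ⟨a, b⟩ h
    simp only [Set.mem_ofPred_eq] at h
    simp only [Set.mem_iUnion]
    exact ⟨(size a, size b), by simpa using h, by simp⟩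

variable {α β : Type} [Graded α] [Graded β]

theorem size_prod (a : α) (b : β) : size (a, b) = size a + size b := rfl

open Classical in
theorem coeff_gf (S : Set α) (n : ℕ) : PowerSeries.coeff n (gf S) =
    ∑ a ∈ (finite_fiber (α := α) n).toFinset with a ∈ S, wt a := by
  rw [gf, PowerSeries.coeff_mk]

theorem gf_empty : gf (∅ : Set α) = 0 := by
  ext n
  simp [coeff_gf]

theorem gf_prod (S : Set α) (S' : Set β) : gf (S ×ˢ S') = gf S * gf S' := by
  classical
  ext n
  rw [PowerSeries.coeff_mul, coeff_gf]
  simp_rw [coeff_gf, Finset.sum_mul_sum, ← Finset.sum_product']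
  rw [← Finset.sum_fiberwise_of_maps_to (t := Finset.HasAntidiagonal.antidiagonal n)
    (g := fun x : α × β => (size x.1, size x.2))]
  · refine Finset.sum_congr rfl fun p hp => Finset.sum_congr ?_ fun x _ => rfl
    rw [Finset.HasAntidiagonal.mem_antidiagonal] at hp
    ext ⟨a, b⟩
    simp only [Finset.mem_filter, Set.Finite.mem_toFinset, Set.mem_ofPred_eq, Set.mem_prod,
      Finset.mem_product, size_prod, Prod.ext_iff]
    constructor
    · rintro ⟨⟨_, h1, h2⟩, h3, h4⟩; exact ⟨⟨h3, h1⟩, h4, h2⟩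
    · rintro ⟨⟨h3, h1⟩, h4, h2⟩; exact ⟨⟨by omega, h1, h2⟩, h3, h4⟩
  · rintro ⟨a, b⟩ h
    simp only [Finset.mem_filter, Set.Finite.mem_toFinset, Set.mem_ofPred_eq, size_prod] at h
    simpa using h.1

theorem gf_fiberwise {ι : Type} [DecidableEq ι] (g : α → ι) (I : Finset ι) (S : Set α)
    (h : ∀ a ∈ S, g a ∈ I) : gf S = ∑ i ∈ I, gf {a | a ∈ S ∧ g a = i} := by
  classical
  ext n
  rw [map_sum, coeff_gf, ← Finset.sum_fiberwise_of_maps_to (t := I) (g := g)]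
  · refine Finset.sum_congr rfl fun i _ => ?_
    rw [coeff_gf]
    refine Finset.sum_congr ?_ fun _ _ => rfl
    ext a; simp [and_assoc]
  · intro a ha
    exact h a (Finset.mem_filter.1 ha).2

theorem gf_split (p : α → Prop) (S : Set α) :
    gf S = gf {a | a ∈ S ∧ p a} + gf {a | a ∈ S ∧ ¬ p a} := by
  classical
  ext n
  rw [map_add, coeff_gf, coeff_gf, coeff_gf, ← Finset.sum_filter_add_sum_filter_not _ p]
  congr 1 <;> refine Finset.sum_congr ?_ fun _ _ => rfl <;> ext a <;> simp [and_assoc]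

theorem gf_bij (k : ℕ) (S : Set α) (S' : Set β) (e : α → β) (he : Set.BijOn e S S')
    (hs : ∀ a ∈ S, size a = size (e a) + k) (hw : ∀ a ∈ S, wt (e a) = wt a) :
    gf S = PowerSeries.X ^ k * gf S' := by
  classical
  ext n
  rw [PowerSeries.coeff_X_pow_mul', coeff_gf]
  split_ifs with hn
  · rw [coeff_gf]
    refine Finset.sum_bij (fun a _ => e a) ?_ ?_ ?_ ?_
    · intro a ha
      simp only [Finset.mem_filter, Set.Finite.mem_toFinset, Set.mem_ofPred_eq] at ha ⊢
      have := hs a ha.2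
      exact ⟨by omega, he.mapsTo ha.2⟩
    · intro a ha b hb hab
      exact he.injOn (Finset.mem_filter.1 ha).2 (Finset.mem_filter.1 hb).2 hab
    · intro b hb
      simp only [Finset.mem_filter, Set.Finite.mem_toFinset, Set.mem_ofPred_eq] at hb ⊢
      obtain ⟨a, ha, rfl⟩ := he.surjOn hb.2
      have := hs a ha
      exact ⟨a, ⟨by omega, ha⟩, rfl⟩
    · intro a ha
      exact (hw a (Finset.mem_filter.1 ha).2).symm
  · refine Finset.sum_eq_zero fun a ha => ?_
    simp only [Finset.mem_filter, Set.Finite.mem_toFinset, Set.mem_ofPred_eq] at ha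
    have := hs a ha.2
    omega

theorem gf_singleton (a : α) : gf {a} = PowerSeries.C (wt a) * PowerSeries.X ^ size a := by
  classical
  ext n
  rw [coeff_gf, PowerSeries.coeff_C_mul, PowerSeries.coeff_X_pow]
  split_ifs with h
  · rw [mul_one, Finset.sum_eq_single a]
    · rintro b hb hba
      exact absurd (Finset.mem_filter.1 hb).2 hba
    · intro hh; simp [h] at hh
  · rw [mul_zero]
    refine Finset.sum_eq_zero fun b hb => ?_
    simp only [Finset.mem_filter, Set.Finite.mem_toFinset, Set.mem_ofPred_eq,
      Set.mem_singleton_iff] at hb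
    rw [hb.2] at hb
    exact absurd hb.1.symm h

theorem gf_singleton_mem (s : PowerSeries ℚ) (a : α) : gf {a} ∈ ratSubalgebra s := by
  rw [gf_singleton]
  exact mul_mem (Subalgebra.algebraMap_mem (ratSubalgebra s) (wt a))
    (pow_mem ratSubalgebra.X_mem _)

theorem gf_mem_of_fibers {ι : Type} {s : PowerSeries ℚ} (g : α → ι) {I : Set ι} (hI : I.Finite)
    (S : Set α) (h : ∀ a ∈ S, g a ∈ I)
    (hm : ∀ i ∈ I, gf {a | a ∈ S ∧ g a = i} ∈ ratSubalgebra s) : gf S ∈ ratSubalgebra s := by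
  classical
  rw [gf_fiberwise g hI.toFinset S (by simpa using h)]
  exact sum_mem fun i hi => hm i (by simpa using hi)

theorem gf_mem_of_finite (s : PowerSeries ℚ) {S : Set α} (hS : S.Finite) :
    gf S ∈ ratSubalgebra s := by
  refine gf_mem_of_fibers id hS S (fun a h => h) fun a ha => ?_
  have : {b | b ∈ S ∧ id b = a} = {a} := by
    ext b; simp only [id, Set.mem_ofPred_eq, Set.mem_singleton_iff]
    exact ⟨fun h => h.2, fun h => ⟨h ▸ ha, h⟩⟩
  rw [this]
  exact gf_singleton_mem s a

theorem finite_size_le (n : ℕ) : {a : α | size a ≤ n}.Finite := by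
  refine ((Set.finite_Iic n).biUnion fun k _ => finite_fiber (α := α) k).subset ?_
  intro a ha
  simp only [Set.mem_iUnion]
  exact ⟨size a, ha, rfl⟩

end Graded

/-! ### Involutions and inflation of a fixed point -/

/-- An involution of `{0, …, n - 1}`, extended by the identity to all natural numbers. -/
@[ext] structure Invol where
  n : ℕ
  f : ℕ → ℕ
  invol : ∀ x, f (f x) = x
  fix : ∀ x, n ≤ x → f x = x

namespace Invol

open Graded

theorem f_lt (A : Invol) {x : ℕ} (hx : x < A.n) : A.f x < A.n := by
  by_contra h
  have h1 := A.fix _ (not_lt.1 h)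
  rw [A.invol] at h1
  omega

theorem f_inj (A : Invol) {x y : ℕ} : A.f x = A.f y ↔ x = y :=
  ⟨fun h => by rw [← A.invol x, h, A.invol], fun h => h ▸ rfl⟩

/-- The involution given by a permutation that is its own inverse. -/
def ofPerm {n : ℕ} (π : Equiv.Perm (Fin n)) (h : π⁻¹ = π) : Invol where
  n := n
  f x := if hx : x < n then π ⟨x, hx⟩ else x
  invol x := by
    by_cases hx : x < n
    · have : π (π ⟨x, hx⟩) = ⟨x, hx⟩ := by
        have h1 : π⁻¹ (π ⟨x, hx⟩) = π (π ⟨x, hx⟩) := by rw [h]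
        rw [← h1]; simp
      simp [hx, this]
    · simp [hx]
  fix x hx := by simp [hx]

/-- The restriction of an involution to a permutation of `Fin n`. -/
def toPerm (A : Invol) : Equiv.Perm (Fin A.n) where
  toFun x := ⟨A.f x, A.f_lt x.2⟩
  invFun x := ⟨A.f x, A.f_lt x.2⟩
  left_inv x := by simp [A.invol]
  right_inv x := by simp [A.invol]

theorem toPerm_inv (A : Invol) : A.toPerm⁻¹ = A.toPerm := rfl

theorem ofPerm_toPerm (A : Invol) : ofPerm A.toPerm A.toPerm_inv = A := by
  ext x
  · rfl
  · by_cases hx : x < A.n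
    · simp [ofPerm, toPerm, hx]
    · simp [ofPerm, hx, A.fix x (not_lt.1 hx)]

theorem exists_ofPerm (A : Invol) {n : ℕ} (h : A.n = n) :
    ∃ (π : Equiv.Perm (Fin n)) (hπ : π⁻¹ = π), ofPerm π hπ = A := by
  subst h
  exact ⟨A.toPerm, A.toPerm_inv, A.ofPerm_toPerm⟩

/-- The number of two-cycles. -/
def arcs (A : Invol) : ℕ := ∑ x ∈ Finset.range A.n, if x < A.f x then 1 else 0

instance : Graded Invol where
  size A := A.n
  wt A := (-1) ^ A.arcs
  finite_fiber n := by
    refine (Set.finite_range fun π : {π : Equiv.Perm (Fin n) // π⁻¹ = π} =>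
      ofPerm π.1 π.2).subset ?_
    intro A hA
    obtain ⟨π, hπ, h⟩ := A.exists_ofPerm hA
    exact ⟨⟨π, hπ⟩, h⟩

/-- The indicator of an occurrence of the pattern `3412` at the positions `i`, `j`, `k`, `l`. -/
def occ4 (A : Invol) (i j k l : ℕ) : ℕ :=
  if i < j ∧ j < k ∧ k < l ∧ A.f k < A.f l ∧ A.f l < A.f i ∧ A.f i < A.f j then 1 else 0

/-- The indicator of an occurrence of the pattern `12` at the positions `i`, `j`. -/
def occ2 (A : Invol) (i j : ℕ) : ℕ := if i < j ∧ A.f i < A.f j then 1 else 0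

/-- The number of occurrences of `3412` plus `D` times the number of occurrences of `12`. -/
def stat (D : ℕ) (A : Invol) : ℕ :=
  (∑ i ∈ Finset.range A.n, ∑ j ∈ Finset.range A.n, ∑ k ∈ Finset.range A.n,
    ∑ l ∈ Finset.range A.n, A.occ4 i j k l) +
  D * ∑ i ∈ Finset.range A.n, ∑ j ∈ Finset.range A.n, A.occ2 i j

/-- The place of the point `x ≠ p` after the point `p` has been replaced by `m` points. -/
def shift (p m x : ℕ) : ℕ := if x < p then x else x + m - 1

/-- Replace the fixed point `p` of `A` by a copy of `B`. -/
def infl (A : Invol) (p : ℕ) (B : Invol) : Invol :=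
  if h : A.f p = p ∧ p < A.n then
  { n := A.n - 1 + B.n
    f := fun y => if y < p then shift p B.n (A.f y) else
      if y < p + B.n then p + B.f (y - p) else shift p B.n (A.f (y + 1 - B.n))
    invol := by
      obtain ⟨hp, hn⟩ := h
      have hne : ∀ x, x ≠ p → A.f x ≠ p := fun x hx he => hx (by rw [← A.invol x, he, hp])
      intro y
      by_cases h1 : y < p
      · have h2 := hne y (by omega)
        have h3 := A.invol y
        by_cases h4 : A.f y < p
        · simp [shift, h1, h3, h4]
        · have h5 : A.f y + B.n - 1 + 1 - B.n = A.f y := by omega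
          have h6 : ¬ A.f y + B.n - 1 < p := by omega
          have h7 : ¬ A.f y + B.n - 1 < p + B.n := by omega
          simp [shift, h1, h3, h4, h5, h6, h7]
      by_cases h2 : y < p + B.n
      · have h3 := B.f_lt (x := y - p) (by omega)
        have h4 := B.invol (y - p)
        simp [h1, h2, h3, h4]
        omega
      · have h0 := hne (y + 1 - B.n) (by omega)
        have h3 := A.invol (y + 1 - B.n)
        have h8 : ¬ y + 1 - B.n < p := by omega
        by_cases h4 : A.f (y + 1 - B.n) < p
        · simp [shift, h1, h2, h3, h4, h8]; omega
        · have h5 : A.f (y + 1 - B.n) + B.n - 1 + 1 - B.n = A.f (y + 1 - B.n) := by omega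
          have h6 : ¬ A.f (y + 1 - B.n) + B.n - 1 < p := by omega
          have h7 : ¬ A.f (y + 1 - B.n) + B.n - 1 < p + B.n := by omega
          simp [shift, h1, h2, h3, h4, h5, h6, h7, h8]; omega
    fix := by
      intro x hx
      have h1 : ¬ x < p := by omega
      have h2 : ¬ x < p + B.n := by omega
      have h3 := A.fix (x + 1 - B.n) (by omega)
      have h8 : ¬ x + 1 - B.n < p := by omega
      simp [shift, h1, h2, h3, h8]; omega }
  else A

section infl

variable {A : Invol} {p : ℕ} (hp : A.f p = p) (hn : p < A.n) (B : Invol)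

include hp in
theorem f_ne {x : ℕ} (hx : x ≠ p) : A.f x ≠ p :=
  fun he => hx (by rw [← A.invol x, he, hp])

include hp hn

theorem infl_n : (A.infl p B).n = A.n - 1 + B.n := by
  rw [infl, dif_pos ⟨hp, hn⟩]

theorem infl_f (y : ℕ) : (A.infl p B).f y = if y < p then shift p B.n (A.f y) else
      if y < p + B.n then p + B.f (y - p) else shift p B.n (A.f (y + 1 - B.n)) := by
  rw [infl, dif_pos ⟨hp, hn⟩]

theorem infl_shift {x : ℕ} (hx : x ≠ p) :
    (A.infl p B).f (shift p B.n x) = shift p B.n (A.f x) := by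
  rw [infl_f hp hn]
  by_cases h : x < p
  · simp [shift, h]
  · have h1 : shift p B.n x = x + B.n - 1 := by simp [shift, h]
    have h2 : x + B.n - 1 + 1 - B.n = x := by omega
    rw [h1, if_neg (by omega), if_neg (by omega), h2]

theorem infl_block {z : ℕ} (hz : z < B.n) : (A.infl p B).f (p + z) = p + B.f z := by
  rw [infl_f hp hn, if_neg (by omega), if_pos (by omega)]
  congr 2; omega

end infl

theorem shift_lt_shift {p m x y : ℕ} (hx : x ≠ p) (hy : y ≠ p) :
    shift p m x < shift p m y ↔ x < y := by
  unfold shift; split_ifs <;> omega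

theorem shift_lt_block {p m x z : ℕ} (hz : z < m) :
    shift p m x < p + z ↔ x < p := by
  unfold shift; split_ifs <;> omega

theorem block_lt_shift {p m x z : ℕ} (hx : x ≠ p) (hz : z < m) :
    p + z < shift p m x ↔ p < x := by
  unfold shift; split_ifs <;> omega

theorem sum_infl {p n : ℕ} (hn : p < n) (m : ℕ) (g : ℕ → ℕ) :
    ∑ y ∈ Finset.range (n - 1 + m), g y =
      ∑ x ∈ (Finset.range n).erase p, g (shift p m x) + ∑ z ∈ Finset.range m, g (p + z) := by
  obtain ⟨q, rfl⟩ : ∃ q, n = p + 1 + q := ⟨n - p - 1, by omega⟩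
  have h1 : p + 1 + q - 1 + m = p + m + q := by omega
  have h2 := Finset.add_sum_erase (Finset.range (p + 1 + q))
    (fun x => if x = p then 0 else g (shift p m x)) (a := p) (by simp; omega)
  have h3 : ∑ x ∈ (Finset.range (p + 1 + q)).erase p, g (shift p m x) =
      ∑ x ∈ (Finset.range (p + 1 + q)).erase p, if x = p then 0 else g (shift p m x) :=
    Finset.sum_congr rfl fun x hx => by rw [if_neg (Finset.ne_of_mem_erase hx)]
  simp only [if_true, zero_add] at h2
  rw [h3, h2, h1, Finset.sum_range_add, Finset.sum_range_add, Finset.sum_range_add,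
    Finset.sum_range_add]
  have h4 : ∑ x ∈ Finset.range p, (if x = p then 0 else g (shift p m x)) =
      ∑ x ∈ Finset.range p, g x := Finset.sum_congr rfl fun x hx => by
    have := Finset.mem_range.1 hx
    rw [if_neg (by omega), shift, if_pos this]
  have h5 : ∑ x ∈ Finset.range q, (if p + 1 + x = p then 0 else g (shift p m (p + 1 + x))) =
      ∑ x ∈ Finset.range q, g (p + m + x) := Finset.sum_congr rfl fun x _ => by
    rw [if_neg (by omega), shift, if_neg (by omega)]
    congr 1; omega
  rw [h4, h5]
  simp
  ring

theorem arcs_infl {A : Invol} {p : ℕ} (hp : A.f p = p) (hn : p < A.n) (B : Invol) :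
    (A.infl p B).arcs = A.arcs + B.arcs := by
  rw [arcs, infl_n hp hn, sum_infl hn, arcs, arcs]
  rw [← Finset.add_sum_erase (Finset.range A.n) _ (a := p) (by simpa using hn), hp,
    if_neg (lt_irrefl _), zero_add]
  congr 1
  · refine Finset.sum_congr rfl fun x hx => ?_
    have hx := Finset.ne_of_mem_erase hx
    rw [infl_shift hp hn B hx, if_congr (shift_lt_shift hx (f_ne hp hx)) rfl rfl]
  · refine Finset.sum_congr rfl fun x hx => ?_
    rw [infl_block hp hn B (Finset.mem_range.1 hx)]
    exact if_congr (by omega) rfl rfl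

end Invol

/-! ### Pattern counts under inflation -/

namespace Invol

/-- The number of crossing pairs of arcs over `p`, on either side of `p`. -/
def cover (A : Invol) (p : ℕ) : ℕ :=
  (∑ k ∈ Finset.range A.n, ∑ l ∈ Finset.range A.n,
    if p < k ∧ k < l ∧ A.f k < A.f l ∧ A.f l < p then 1 else 0) +
  ∑ i ∈ Finset.range A.n, ∑ j ∈ Finset.range A.n,
    if i < j ∧ j < p ∧ p < A.f i ∧ A.f i < A.f j then 1 else 0

theorem sum_congr_four {s₁ s₂ s₃ s₄ : Finset ℕ} {F G : ℕ → ℕ → ℕ → ℕ → ℕ}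
    (h : ∀ i ∈ s₁, ∀ j ∈ s₂, ∀ k ∈ s₃, ∀ l ∈ s₄, F i j k l = G i j k l) :
    ∑ i ∈ s₁, ∑ j ∈ s₂, ∑ k ∈ s₃, ∑ l ∈ s₄, F i j k l =
      ∑ i ∈ s₁, ∑ j ∈ s₂, ∑ k ∈ s₃, ∑ l ∈ s₄, G i j k l :=
  Finset.sum_congr rfl fun i hi => Finset.sum_congr rfl fun j hj =>
    Finset.sum_congr rfl fun k hk => Finset.sum_congr rfl fun l hl => h i hi j hj k hk l hl

theorem sum_eq_zero_four {s₁ s₂ s₃ s₄ : Finset ℕ} {F : ℕ → ℕ → ℕ → ℕ → ℕ}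
    (h : ∀ i ∈ s₁, ∀ j ∈ s₂, ∀ k ∈ s₃, ∀ l ∈ s₄, F i j k l = 0) :
    ∑ i ∈ s₁, ∑ j ∈ s₂, ∑ k ∈ s₃, ∑ l ∈ s₄, F i j k l = 0 :=
  Finset.sum_eq_zero fun i hi => Finset.sum_eq_zero fun j hj =>
    Finset.sum_eq_zero fun k hk => Finset.sum_eq_zero fun l hl => h i hi j hj k hk l hl

section

variable {A : Invol} {p : ℕ} (hp : A.f p = p) (hn : p < A.n)

include hp hn

-- The block is an interval both in positions and in values. So an occurrence of 3412 meeting it in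
-- exactly two points uses them as "34" or as "12", and the other two points form a crossing pair
-- counted by `cover`; three points in the block are impossible. Occurrences with one point in the
-- block give the term linear in `B.n`.
set_option linter.unusedSimpArgs false in
theorem sum_occ4_infl : ∃ a c, ∀ B : Invol,
    (∑ i ∈ Finset.range (A.infl p B).n, ∑ j ∈ Finset.range (A.infl p B).n,
      ∑ k ∈ Finset.range (A.infl p B).n, ∑ l ∈ Finset.range (A.infl p B).n,
        (A.infl p B).occ4 i j k l) =
    a + c * B.n + ((∑ i ∈ Finset.range B.n, ∑ j ∈ Finset.range B.n, ∑ k ∈ Finset.range B.n,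
      ∑ l ∈ Finset.range B.n, B.occ4 i j k l) +
        A.cover p * ∑ i ∈ Finset.range B.n, ∑ j ∈ Finset.range B.n, B.occ2 i j) := by
  set o := (Finset.range A.n).erase p with ho
  have hne : ∀ x ∈ o, x ≠ p := fun x hx => Finset.ne_of_mem_erase hx
  have hfne : ∀ x ∈ o, A.f x ≠ p := fun x hx => f_ne hp (hne x hx)
  have e1 : ∑ k ∈ Finset.range A.n, ∑ l ∈ Finset.range A.n,
      (if p < k ∧ k < l ∧ A.f k < A.f l ∧ A.f l < p then 1 else 0) =
      ∑ k ∈ o, ∑ l ∈ o, if p < k ∧ k < l ∧ A.f k < A.f l ∧ A.f l < p then 1 else 0 := by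
    rw [← Finset.sum_erase (Finset.range A.n) (a := p)]
    · refine Finset.sum_congr rfl fun k _ => ?_
      rw [← Finset.sum_erase (Finset.range A.n) (a := p)]
      rw [if_neg (by omega)]
    · simp
  have e2 : ∑ i ∈ Finset.range A.n, ∑ j ∈ Finset.range A.n,
      (if i < j ∧ j < p ∧ p < A.f i ∧ A.f i < A.f j then 1 else 0) =
      ∑ i ∈ o, ∑ j ∈ o, if i < j ∧ j < p ∧ p < A.f i ∧ A.f i < A.f j then 1 else 0 := by
    rw [← Finset.sum_erase (Finset.range A.n) (a := p)]
    · refine Finset.sum_congr rfl fun k _ => ?_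
      rw [← Finset.sum_erase (Finset.range A.n) (a := p)]
      rw [if_neg (by omega)]
    · simp [hp]
  rw [cover, e1, e2]
  refine ⟨∑ i ∈ o, ∑ j ∈ o, ∑ k ∈ o, ∑ l ∈ o, A.occ4 i j k l,
    (∑ j ∈ o, ∑ k ∈ o, ∑ l ∈ o,
      if p < j ∧ j < k ∧ k < l ∧ A.f k < A.f l ∧ A.f l < p ∧ p < A.f j then 1 else 0) +
    (∑ i ∈ o, ∑ k ∈ o, ∑ l ∈ o,
      if i < p ∧ p < k ∧ k < l ∧ A.f k < A.f l ∧ A.f l < A.f i ∧ A.f i < p then 1 else 0) +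
    (∑ i ∈ o, ∑ j ∈ o, ∑ l ∈ o,
      if i < j ∧ j < p ∧ p < l ∧ p < A.f l ∧ A.f l < A.f i ∧ A.f i < A.f j then 1 else 0) +
    (∑ i ∈ o, ∑ j ∈ o, ∑ k ∈ o,
      if i < j ∧ j < k ∧ k < p ∧ A.f k < p ∧ p < A.f i ∧ A.f i < A.f j then 1 else 0),
    fun B => ?_⟩
  have fo : ∀ x ∈ o, x ≠ p ∧ A.f x ≠ p ∧
      (A.infl p B).f (shift p B.n x) = shift p B.n (A.f x) := fun x hx =>
    ⟨hne x hx, hfne x hx, infl_shift hp hn B (hne x hx)⟩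
  have fb : ∀ z ∈ Finset.range B.n, z < B.n ∧ B.f z < B.n ∧
      (A.infl p B).f (p + z) = p + B.f z := fun z hz =>
    have hz := Finset.mem_range.1 hz
    ⟨hz, B.f_lt hz, infl_block hp hn B hz⟩
  -- The four digits in the names of the sixteen sums tell which of the positions `i`, `j`, `k`, `l`
  -- lie in the block.
  have h0000 : ∑ i ∈ o, ∑ j ∈ o, ∑ k ∈ o, ∑ l ∈ o, (A.infl p B).occ4 (shift p B.n i) (shift p B.n
      j) (shift p B.n k) (shift p B.n l) =
      ∑ i ∈ o, ∑ j ∈ o, ∑ k ∈ o, ∑ l ∈ o, A.occ4 i j k l := by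
    refine sum_congr_four fun i hi j hj k hk l hl => ?_
    obtain ⟨i1, i2, i3⟩ := fo i hi
    obtain ⟨j1, j2, j3⟩ := fo j hj
    obtain ⟨k1, k2, k3⟩ := fo k hk
    obtain ⟨l1, l2, l3⟩ := fo l hl
    simp only [occ4, i3, j3, k3, l3, shift_lt_shift, shift_lt_block, block_lt_shift,
      add_lt_add_iff_left, i1, i2, j1, j2, k1, k2, l1, l2, ne_eq, not_false_eq_true]
  have h0001 : ∑ i ∈ o, ∑ j ∈ o, ∑ k ∈ o, ∑ l ∈ Finset.range B.n, (A.infl p B).occ4 (shift p B.n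
      i) (shift p B.n j) (shift p B.n k) (p + l) =
      ∑ i ∈ o, ∑ j ∈ o, ∑ k ∈ o, ∑ l ∈ Finset.range B.n, if i < j ∧ j < k ∧ k < p ∧ A.f k < p ∧ p
        < A.f i ∧ A.f i < A.f j then 1 else 0 := by
    refine sum_congr_four fun i hi j hj k hk l hl => ?_
    obtain ⟨i1, i2, i3⟩ := fo i hi
    obtain ⟨j1, j2, j3⟩ := fo j hj
    obtain ⟨k1, k2, k3⟩ := fo k hk
    obtain ⟨l1, l2, l3⟩ := fb l hl
    simp only [occ4, i3, j3, k3, l3, shift_lt_shift, shift_lt_block, block_lt_shift,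
      add_lt_add_iff_left, i1, i2, j1, j2, k1, k2, l1, l2, ne_eq, not_false_eq_true]
  have h0010 : ∑ i ∈ o, ∑ j ∈ o, ∑ k ∈ Finset.range B.n, ∑ l ∈ o, (A.infl p B).occ4 (shift p B.n
      i) (shift p B.n j) (p + k) (shift p B.n l) =
      ∑ i ∈ o, ∑ j ∈ o, ∑ k ∈ Finset.range B.n, ∑ l ∈ o, if i < j ∧ j < p ∧ p < l ∧ p < A.f l ∧
        A.f l < A.f i ∧ A.f i < A.f j then 1 else 0 := by
    refine sum_congr_four fun i hi j hj k hk l hl => ?_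
    obtain ⟨i1, i2, i3⟩ := fo i hi
    obtain ⟨j1, j2, j3⟩ := fo j hj
    obtain ⟨k1, k2, k3⟩ := fb k hk
    obtain ⟨l1, l2, l3⟩ := fo l hl
    simp only [occ4, i3, j3, k3, l3, shift_lt_shift, shift_lt_block, block_lt_shift,
      add_lt_add_iff_left, i1, i2, j1, j2, k1, k2, l1, l2, ne_eq, not_false_eq_true]
  have h0011 : ∑ i ∈ o, ∑ j ∈ o, ∑ k ∈ Finset.range B.n, ∑ l ∈ Finset.range B.n, (A.infl p B).occ4
      (shift p B.n i) (shift p B.n j) (p + k) (p + l) =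
      ∑ i ∈ o, ∑ j ∈ o, ∑ k ∈ Finset.range B.n, ∑ l ∈ Finset.range B.n, (if i < j ∧ j < p ∧ p <
        A.f i ∧ A.f i < A.f j then 1 else 0) * B.occ2 k l := by
    refine sum_congr_four fun i hi j hj k hk l hl => ?_
    obtain ⟨i1, i2, i3⟩ := fo i hi
    obtain ⟨j1, j2, j3⟩ := fo j hj
    obtain ⟨k1, k2, k3⟩ := fb k hk
    obtain ⟨l1, l2, l3⟩ := fb l hl
    simp only [occ4, i3, j3, k3, l3, shift_lt_shift, shift_lt_block, block_lt_shift,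
      add_lt_add_iff_left, i1, i2, j1, j2, k1, k2, l1, l2, ne_eq, not_false_eq_true]
    simp only [occ2, ite_and, ite_mul, one_mul, zero_mul]
    split_ifs <;> omega
  have h0100 : ∑ i ∈ o, ∑ j ∈ Finset.range B.n, ∑ k ∈ o, ∑ l ∈ o, (A.infl p B).occ4 (shift p B.n
      i) (p + j) (shift p B.n k) (shift p B.n l) =
      ∑ i ∈ o, ∑ j ∈ Finset.range B.n, ∑ k ∈ o, ∑ l ∈ o, if i < p ∧ p < k ∧ k < l ∧ A.f k < A.f l
        ∧ A.f l < A.f i ∧ A.f i < p then 1 else 0 := by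
    refine sum_congr_four fun i hi j hj k hk l hl => ?_
    obtain ⟨i1, i2, i3⟩ := fo i hi
    obtain ⟨j1, j2, j3⟩ := fb j hj
    obtain ⟨k1, k2, k3⟩ := fo k hk
    obtain ⟨l1, l2, l3⟩ := fo l hl
    simp only [occ4, i3, j3, k3, l3, shift_lt_shift, shift_lt_block, block_lt_shift,
      add_lt_add_iff_left, i1, i2, j1, j2, k1, k2, l1, l2, ne_eq, not_false_eq_true]
  have h0101 : ∑ i ∈ o, ∑ j ∈ Finset.range B.n, ∑ k ∈ o, ∑ l ∈ Finset.range B.n, (A.infl p B).occ4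
      (shift p B.n i) (p + j) (shift p B.n k) (p + l) =
      0 := by
    refine sum_eq_zero_four fun i hi j hj k hk l hl => ?_
    obtain ⟨i1, i2, i3⟩ := fo i hi
    obtain ⟨j1, j2, j3⟩ := fb j hj
    obtain ⟨k1, k2, k3⟩ := fo k hk
    obtain ⟨l1, l2, l3⟩ := fb l hl
    simp only [occ4, i3, j3, k3, l3, shift_lt_shift, shift_lt_block, block_lt_shift,
      add_lt_add_iff_left, i1, i2, j1, j2, k1, k2, l1, l2, ne_eq, not_false_eq_true]
    exact if_neg (by omega)
  have h0110 : ∑ i ∈ o, ∑ j ∈ Finset.range B.n, ∑ k ∈ Finset.range B.n, ∑ l ∈ o, (A.infl p B).occ4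
      (shift p B.n i) (p + j) (p + k) (shift p B.n l) =
      0 := by
    refine sum_eq_zero_four fun i hi j hj k hk l hl => ?_
    obtain ⟨i1, i2, i3⟩ := fo i hi
    obtain ⟨j1, j2, j3⟩ := fb j hj
    obtain ⟨k1, k2, k3⟩ := fb k hk
    obtain ⟨l1, l2, l3⟩ := fo l hl
    simp only [occ4, i3, j3, k3, l3, shift_lt_shift, shift_lt_block, block_lt_shift,
      add_lt_add_iff_left, i1, i2, j1, j2, k1, k2, l1, l2, ne_eq, not_false_eq_true]
    exact if_neg (by omega)
  have h0111 : ∑ i ∈ o, ∑ j ∈ Finset.range B.n, ∑ k ∈ Finset.range B.n, ∑ l ∈ Finset.range B.n,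
      (A.infl p B).occ4 (shift p B.n i) (p + j) (p + k) (p + l) =
      0 := by
    refine sum_eq_zero_four fun i hi j hj k hk l hl => ?_
    obtain ⟨i1, i2, i3⟩ := fo i hi
    obtain ⟨j1, j2, j3⟩ := fb j hj
    obtain ⟨k1, k2, k3⟩ := fb k hk
    obtain ⟨l1, l2, l3⟩ := fb l hl
    simp only [occ4, i3, j3, k3, l3, shift_lt_shift, shift_lt_block, block_lt_shift,
      add_lt_add_iff_left, i1, i2, j1, j2, k1, k2, l1, l2, ne_eq, not_false_eq_true]
    exact if_neg (by omega)
  have h1000 : ∑ i ∈ Finset.range B.n, ∑ j ∈ o, ∑ k ∈ o, ∑ l ∈ o, (A.infl p B).occ4 (p + i) (shift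
      p B.n j) (shift p B.n k) (shift p B.n l) =
      ∑ i ∈ Finset.range B.n, ∑ j ∈ o, ∑ k ∈ o, ∑ l ∈ o, if p < j ∧ j < k ∧ k < l ∧ A.f k < A.f l
        ∧ A.f l < p ∧ p < A.f j then 1 else 0 := by
    refine sum_congr_four fun i hi j hj k hk l hl => ?_
    obtain ⟨i1, i2, i3⟩ := fb i hi
    obtain ⟨j1, j2, j3⟩ := fo j hj
    obtain ⟨k1, k2, k3⟩ := fo k hk
    obtain ⟨l1, l2, l3⟩ := fo l hl
    simp only [occ4, i3, j3, k3, l3, shift_lt_shift, shift_lt_block, block_lt_shift,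
      add_lt_add_iff_left, i1, i2, j1, j2, k1, k2, l1, l2, ne_eq, not_false_eq_true]
  have h1001 : ∑ i ∈ Finset.range B.n, ∑ j ∈ o, ∑ k ∈ o, ∑ l ∈ Finset.range B.n, (A.infl p B).occ4
      (p + i) (shift p B.n j) (shift p B.n k) (p + l) =
      0 := by
    refine sum_eq_zero_four fun i hi j hj k hk l hl => ?_
    obtain ⟨i1, i2, i3⟩ := fb i hi
    obtain ⟨j1, j2, j3⟩ := fo j hj
    obtain ⟨k1, k2, k3⟩ := fo k hk
    obtain ⟨l1, l2, l3⟩ := fb l hl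
    simp only [occ4, i3, j3, k3, l3, shift_lt_shift, shift_lt_block, block_lt_shift,
      add_lt_add_iff_left, i1, i2, j1, j2, k1, k2, l1, l2, ne_eq, not_false_eq_true]
    exact if_neg (by omega)
  have h1010 : ∑ i ∈ Finset.range B.n, ∑ j ∈ o, ∑ k ∈ Finset.range B.n, ∑ l ∈ o, (A.infl p B).occ4
      (p + i) (shift p B.n j) (p + k) (shift p B.n l) =
      0 := by
    refine sum_eq_zero_four fun i hi j hj k hk l hl => ?_
    obtain ⟨i1, i2, i3⟩ := fb i hi
    obtain ⟨j1, j2, j3⟩ := fo j hj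
    obtain ⟨k1, k2, k3⟩ := fb k hk
    obtain ⟨l1, l2, l3⟩ := fo l hl
    simp only [occ4, i3, j3, k3, l3, shift_lt_shift, shift_lt_block, block_lt_shift,
      add_lt_add_iff_left, i1, i2, j1, j2, k1, k2, l1, l2, ne_eq, not_false_eq_true]
    exact if_neg (by omega)
  have h1011 : ∑ i ∈ Finset.range B.n, ∑ j ∈ o, ∑ k ∈ Finset.range B.n, ∑ l ∈ Finset.range B.n,
      (A.infl p B).occ4 (p + i) (shift p B.n j) (p + k) (p + l) =
      0 := by
    refine sum_eq_zero_four fun i hi j hj k hk l hl => ?_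
    obtain ⟨i1, i2, i3⟩ := fb i hi
    obtain ⟨j1, j2, j3⟩ := fo j hj
    obtain ⟨k1, k2, k3⟩ := fb k hk
    obtain ⟨l1, l2, l3⟩ := fb l hl
    simp only [occ4, i3, j3, k3, l3, shift_lt_shift, shift_lt_block, block_lt_shift,
      add_lt_add_iff_left, i1, i2, j1, j2, k1, k2, l1, l2, ne_eq, not_false_eq_true]
    exact if_neg (by omega)
  have h1100 : ∑ i ∈ Finset.range B.n, ∑ j ∈ Finset.range B.n, ∑ k ∈ o, ∑ l ∈ o, (A.infl p B).occ4
      (p + i) (p + j) (shift p B.n k) (shift p B.n l) =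
      ∑ i ∈ Finset.range B.n, ∑ j ∈ Finset.range B.n, ∑ k ∈ o, ∑ l ∈ o, B.occ2 i j * if p < k ∧ k
        < l ∧ A.f k < A.f l ∧ A.f l < p then 1 else 0 := by
    refine sum_congr_four fun i hi j hj k hk l hl => ?_
    obtain ⟨i1, i2, i3⟩ := fb i hi
    obtain ⟨j1, j2, j3⟩ := fb j hj
    obtain ⟨k1, k2, k3⟩ := fo k hk
    obtain ⟨l1, l2, l3⟩ := fo l hl
    simp only [occ4, i3, j3, k3, l3, shift_lt_shift, shift_lt_block, block_lt_shift,
      add_lt_add_iff_left, i1, i2, j1, j2, k1, k2, l1, l2, ne_eq, not_false_eq_true]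
    simp only [occ2, ite_and, ite_mul, one_mul, zero_mul]
    split_ifs <;> omega
  have h1101 : ∑ i ∈ Finset.range B.n, ∑ j ∈ Finset.range B.n, ∑ k ∈ o, ∑ l ∈ Finset.range B.n,
      (A.infl p B).occ4 (p + i) (p + j) (shift p B.n k) (p + l) =
      0 := by
    refine sum_eq_zero_four fun i hi j hj k hk l hl => ?_
    obtain ⟨i1, i2, i3⟩ := fb i hi
    obtain ⟨j1, j2, j3⟩ := fb j hj
    obtain ⟨k1, k2, k3⟩ := fo k hk
    obtain ⟨l1, l2, l3⟩ := fb l hl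
    simp only [occ4, i3, j3, k3, l3, shift_lt_shift, shift_lt_block, block_lt_shift,
      add_lt_add_iff_left, i1, i2, j1, j2, k1, k2, l1, l2, ne_eq, not_false_eq_true]
    exact if_neg (by omega)
  have h1110 : ∑ i ∈ Finset.range B.n, ∑ j ∈ Finset.range B.n, ∑ k ∈ Finset.range B.n, ∑ l ∈ o,
      (A.infl p B).occ4 (p + i) (p + j) (p + k) (shift p B.n l) =
      0 := by
    refine sum_eq_zero_four fun i hi j hj k hk l hl => ?_
    obtain ⟨i1, i2, i3⟩ := fb i hi
    obtain ⟨j1, j2, j3⟩ := fb j hj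
    obtain ⟨k1, k2, k3⟩ := fb k hk
    obtain ⟨l1, l2, l3⟩ := fo l hl
    simp only [occ4, i3, j3, k3, l3, shift_lt_shift, shift_lt_block, block_lt_shift,
      add_lt_add_iff_left, i1, i2, j1, j2, k1, k2, l1, l2, ne_eq, not_false_eq_true]
    exact if_neg (by omega)
  have h1111 : ∑ i ∈ Finset.range B.n, ∑ j ∈ Finset.range B.n, ∑ k ∈ Finset.range B.n, ∑ l ∈
      Finset.range B.n, (A.infl p B).occ4 (p + i) (p + j) (p + k) (p + l) =
      ∑ i ∈ Finset.range B.n, ∑ j ∈ Finset.range B.n, ∑ k ∈ Finset.range B.n, ∑ l ∈ Finset.range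
        B.n, B.occ4 i j k l := by
    refine sum_congr_four fun i hi j hj k hk l hl => ?_
    obtain ⟨i1, i2, i3⟩ := fb i hi
    obtain ⟨j1, j2, j3⟩ := fb j hj
    obtain ⟨k1, k2, k3⟩ := fb k hk
    obtain ⟨l1, l2, l3⟩ := fb l hl
    simp only [occ4, i3, j3, k3, l3, shift_lt_shift, shift_lt_block, block_lt_shift,
      add_lt_add_iff_left, i1, i2, j1, j2, k1, k2, l1, l2, ne_eq, not_false_eq_true]
  simp only [infl_n hp hn, sum_infl hn, Finset.sum_add_distrib]
  rw [← ho, h0000, h0001, h0010, h0011, h0100, h0101, h0110, h0111,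
    h1000, h1001, h1010, h1011, h1100, h1101, h1110, h1111]
  simp only [← Finset.mul_sum, ← Finset.sum_mul, Finset.sum_const, Finset.card_range, smul_eq_mul]
  ring

-- A point of `A` to the lower left or upper right of `p` forms a 12 with every point of the block,
-- whence the bound on `c`.
set_option linter.unusedSimpArgs false in
theorem sum_occ2_infl : ∃ a c, ((∃ i < A.n, i < p ∧ A.f i < p ∨ p < i ∧ p < A.f i) → 1 ≤ c) ∧ ∀ B
  : Invol,
    (∑ i ∈ Finset.range (A.infl p B).n, ∑ j ∈ Finset.range (A.infl p B).n,
        (A.infl p B).occ2 i j) =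
    a + c * B.n + ∑ i ∈ Finset.range B.n, ∑ j ∈ Finset.range B.n, B.occ2 i j := by
  set o := (Finset.range A.n).erase p with ho
  have hne : ∀ x ∈ o, x ≠ p := fun x hx => Finset.ne_of_mem_erase hx
  have hfne : ∀ x ∈ o, A.f x ≠ p := fun x hx => f_ne hp (hne x hx)
  refine ⟨∑ i ∈ o, ∑ j ∈ o, A.occ2 i j, (∑ i ∈ o, if i < p ∧ A.f i < p then 1 else 0) +
    ∑ j ∈ o, if p < j ∧ p < A.f j then 1 else 0, ?_, fun B => ?_⟩
  · rintro ⟨i, hi, hfi⟩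
    have hio : i ∈ o := by
      rw [ho, Finset.mem_erase, Finset.mem_range]; omega
    rcases hfi with hfi | hfi
    · have h1 := Finset.single_le_sum (f := fun i => if i < p ∧ A.f i < p then 1 else 0)
        (fun _ _ => Nat.zero_le _) hio
      simp only [hfi, and_self, if_true] at h1
      omega
    · have h1 := Finset.single_le_sum (f := fun i => if p < i ∧ p < A.f i then 1 else 0)
        (fun _ _ => Nat.zero_le _) hio
      simp only [hfi, and_self, if_true] at h1
      omega
  have h00 : ∑ i ∈ o, ∑ j ∈ o, (A.infl p B).occ2 (shift p B.n i) (shift p B.n j) =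
      ∑ i ∈ o, ∑ j ∈ o, A.occ2 i j := by
    refine Finset.sum_congr rfl fun i hi => Finset.sum_congr rfl fun j hj => ?_
    simp only [occ2, infl_shift hp hn B (hne i hi), infl_shift hp hn B (hne j hj), shift_lt_shift,
      hne i hi, hne j hj, hfne i hi, hfne j hj, ne_eq, not_false_eq_true]
  have h01 : ∑ i ∈ o, ∑ j ∈ Finset.range B.n, (A.infl p B).occ2 (shift p B.n i) (p + j) =
      ∑ i ∈ o, ∑ j ∈ Finset.range B.n, if i < p ∧ A.f i < p then 1 else 0 := by
    refine Finset.sum_congr rfl fun i hi => Finset.sum_congr rfl fun j hj => ?_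
    have hj := Finset.mem_range.1 hj
    simp only [occ2, infl_shift hp hn B (hne i hi), infl_block hp hn B hj, shift_lt_block,
      hne i hi, hfne i hi, hj, B.f_lt hj, ne_eq, not_false_eq_true]
  have h10 : ∑ i ∈ Finset.range B.n, ∑ j ∈ o, (A.infl p B).occ2 (p + i) (shift p B.n j) =
      ∑ i ∈ Finset.range B.n, ∑ j ∈ o, if p < j ∧ p < A.f j then 1 else 0 := by
    refine Finset.sum_congr rfl fun i hi => Finset.sum_congr rfl fun j hj => ?_
    have hi := Finset.mem_range.1 hi
    simp only [occ2, infl_shift hp hn B (hne j hj), infl_block hp hn B hi, block_lt_shift,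
      hne j hj, hfne j hj, hi, B.f_lt hi, ne_eq, not_false_eq_true]
  have h11 : ∑ i ∈ Finset.range B.n, ∑ j ∈ Finset.range B.n, (A.infl p B).occ2 (p + i) (p + j) =
      ∑ i ∈ Finset.range B.n, ∑ j ∈ Finset.range B.n, B.occ2 i j := by
    refine Finset.sum_congr rfl fun i hi => Finset.sum_congr rfl fun j hj => ?_
    rw [Finset.mem_range] at hi hj
    simp only [occ2, infl_block hp hn B hi, infl_block hp hn B hj, add_lt_add_iff_left]
  simp only [infl_n hp hn, sum_infl hn, Finset.sum_add_distrib]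
  rw [← ho, h00, h01, h10, h11]
  simp only [← Finset.mul_sum, ← Finset.sum_mul, Finset.sum_const, Finset.card_range, smul_eq_mul]
  ring

/-- The family `stat D` is closed under inflation, up to an affine function of the block size: the
arcs over `p` only raise the multiplicity of 12. -/
theorem stat_infl (D : ℕ) : ∃ a c, ((∃ i < A.n, i < p ∧ A.f i < p ∨ p < i ∧ p < A.f i) → D ≤ c) ∧
  ∀ B : Invol,
    stat D (A.infl p B) = a + c * B.n + stat (D + A.cover p) B := by
  obtain ⟨a, c, h⟩ := sum_occ4_infl hp hn
  obtain ⟨a', c', hc', h'⟩ := sum_occ2_infl hp hn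
  refine ⟨a + D * a', c + D * c', fun hi => ?_, fun B => ?_⟩
  · have := Nat.mul_le_mul_left D (hc' hi); omega
  · rw [stat, h, h', stat]; ring

/-- The block is invariant and lies entirely to the left of the moved `q`, so none of its arcs
passes over that point. -/
theorem cover_infl {q : ℕ} (hpq : p < q) (B : Invol) :
    (A.infl p B).cover (q - 1 + B.n) = A.cover q := by
  have hs : q - 1 + B.n = shift p B.n q := by unfold shift; split_ifs <;> omega
  rw [hs]
  set o := (Finset.range A.n).erase p with ho
  have hne : ∀ x ∈ o, x ≠ p := fun x hx => Finset.ne_of_mem_erase hx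
  have hfne : ∀ x ∈ o, A.f x ≠ p := fun x hx => f_ne hp (hne x hx)
  have hq : q ≠ p := by omega
  have e1 : ∑ k ∈ Finset.range A.n, ∑ l ∈ Finset.range A.n,
      (if q < k ∧ k < l ∧ A.f k < A.f l ∧ A.f l < q then 1 else 0) =
      ∑ k ∈ o, ∑ l ∈ o, if q < k ∧ k < l ∧ A.f k < A.f l ∧ A.f l < q then 1 else 0 := by
    rw [← Finset.sum_erase (Finset.range A.n) (a := p)]
    · refine Finset.sum_congr rfl fun k _ => ?_
      rw [← Finset.sum_erase (Finset.range A.n) (a := p)]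
      rw [if_neg (by omega)]
    · exact Finset.sum_eq_zero fun l _ => if_neg (by omega)
  have e2 : ∑ i ∈ Finset.range A.n, ∑ j ∈ Finset.range A.n,
      (if i < j ∧ j < q ∧ q < A.f i ∧ A.f i < A.f j then 1 else 0) =
      ∑ i ∈ o, ∑ j ∈ o, if i < j ∧ j < q ∧ q < A.f i ∧ A.f i < A.f j then 1 else 0 := by
    rw [← Finset.sum_erase (Finset.range A.n) (a := p)]
    · refine Finset.sum_congr rfl fun k _ => ?_
      rw [← Finset.sum_erase (Finset.range A.n) (a := p)]
      rw [if_neg (by omega)]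
    · exact Finset.sum_eq_zero fun l _ => if_neg (by omega)
  have zero : ∀ z ∈ Finset.range B.n, p + z < shift p B.n q ∧ p + B.f z < shift p B.n q := by
    intro z hz
    rw [Finset.mem_range] at hz
    rw [block_lt_shift hq hz, block_lt_shift hq (B.f_lt hz)]
    exact ⟨hpq, hpq⟩
  rw [cover, cover, e1, e2, infl_n hp hn]
  simp only [sum_infl hn, Finset.sum_add_distrib]
  rw [← ho]
  have hb : ∀ z ∈ Finset.range B.n, (A.infl p B).f (p + z) < shift p B.n q := fun z hz => by
    rw [infl_block hp hn B (Finset.mem_range.1 hz)]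
    exact (zero z hz).2
  have h00 : ∑ k ∈ o, ∑ l ∈ o, (if shift p B.n q < shift p B.n k ∧ shift p B.n k < shift p B.n l ∧
        (A.infl p B).f (shift p B.n k) < (A.infl p B).f (shift p B.n l) ∧
        (A.infl p B).f (shift p B.n l) < shift p B.n q then 1 else 0) =
      ∑ k ∈ o, ∑ l ∈ o, if q < k ∧ k < l ∧ A.f k < A.f l ∧ A.f l < q then 1 else 0 := by
    refine Finset.sum_congr rfl fun i hi => Finset.sum_congr rfl fun j hj => ?_
    simp only [infl_shift hp hn B (hne i hi), infl_shift hp hn B (hne j hj), shift_lt_shift,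
      hne i hi, hne j hj, hfne i hi, hfne j hj, hq, ne_eq, not_false_eq_true]
  have h00' : ∑ i ∈ o, ∑ j ∈ o, (if shift p B.n i < shift p B.n j ∧
        shift p B.n j < shift p B.n q ∧ shift p B.n q < (A.infl p B).f (shift p B.n i) ∧
        (A.infl p B).f (shift p B.n i) < (A.infl p B).f (shift p B.n j) then 1 else 0) =
      ∑ i ∈ o, ∑ j ∈ o, if i < j ∧ j < q ∧ q < A.f i ∧ A.f i < A.f j then 1 else 0 := by
    refine Finset.sum_congr rfl fun i hi => Finset.sum_congr rfl fun j hj => ?_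
    simp only [infl_shift hp hn B (hne i hi), infl_shift hp hn B (hne j hj), shift_lt_shift,
      hne i hi, hne j hj, hfne i hi, hfne j hj, hq, ne_eq, not_false_eq_true]
  rw [h00, h00']
  have z0 : ∀ (s : Finset ℕ) (P : ℕ → ℕ → Prop) [∀ i j, Decidable (P i j)],
      (∀ i ∈ s, ∀ j ∈ Finset.range B.n, ¬ P i j) →
      ∑ i ∈ s, ∑ j ∈ Finset.range B.n, (if P i j then 1 else 0) = 0 := fun s P _ h =>
    Finset.sum_eq_zero fun i hi => Finset.sum_eq_zero fun j hj => if_neg (h i hi j hj)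
  have z1 : ∀ (s : Finset ℕ) (P : ℕ → ℕ → Prop) [∀ i j, Decidable (P i j)],
      (∀ i ∈ Finset.range B.n, ∀ j ∈ s, ¬ P i j) →
      ∑ i ∈ Finset.range B.n, ∑ j ∈ s, (if P i j then 1 else 0) = 0 := fun s P _ h =>
    Finset.sum_eq_zero fun i hi => Finset.sum_eq_zero fun j hj => if_neg (h i hi j hj)
  rw [z0 o, z0 o, z1 o, z1 o, z0, z0]
  · ring
  all_goals
    intro i hi j hj h
    first
      | have := zero i hi; have := hb i hi; omega
      | have := zero j hj; have := hb j hj; omega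

end
end Invol

/-! ### Crossings and repeated inflation -/

namespace Invol

theorem infl_fixed_lt {A : Invol} {p : ℕ} (hp : A.f p = p) (hn : p < A.n) (B : Invol) {q : ℕ}
    (hq : A.f q = q) (hqp : q < p) : (A.infl p B).f q = q := by
  rw [infl_f hp hn, if_pos hqp, hq, shift, if_pos hqp]

theorem infl_fixed_gt {A : Invol} {p : ℕ} (hp : A.f p = p) (hn : p < A.n) (B : Invol) {q : ℕ}
    (hq : A.f q = q) (hqp : p < q) : (A.infl p B).f (q - 1 + B.n) = q - 1 + B.n := by
  have h := infl_shift hp hn B (x := q) (by omega)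
  have h1 : shift p B.n q = q - 1 + B.n := by rw [shift, if_neg (by omega)]; omega
  rwa [hq, h1] at h

theorem infl_comm {A : Invol} {p q : ℕ} (hp : A.f p = p) (hn : p < A.n) (hq : A.f q = q)
    (hqp : q < p) (B C : Invol) :
    (A.infl p B).infl q C = (A.infl q C).infl (p - 1 + C.n) B := by
  have h1 := infl_fixed_lt hp hn B hq hqp
  have h2 := infl_fixed_gt hq (hqp.trans hn) C hp hqp
  have n1 := infl_n hp hn B
  have n2 := infl_n hq (hqp.trans hn) C
  have h3 : q < (A.infl p B).n := by omega
  have h4 : p - 1 + C.n < (A.infl q C).n := by omega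
  ext y
  · rw [infl_n h1 h3, infl_n h2 h4]; omega
  · have hne : ∀ x, x ≠ p → x ≠ q → A.f x ≠ p ∧ A.f x ≠ q := fun x a b => ⟨f_ne hp a, f_ne hq b⟩
    rw [infl_f h1 h3, infl_f h2 h4]
    simp only [infl_f hp hn, infl_f hq (hqp.trans hn)]
    by_cases c1 : y < q
    · have := hne y (by omega) (by omega)
      have c2 : y < p := by omega
      have c3 : y < p - 1 + C.n := by omega
      simp only [c1, c2, c3, if_true, shift]
      split_ifs <;> omega
    by_cases c2 : y < q + C.n
    · have c3 : y < p - 1 + C.n := by omega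
      have := C.f_lt (x := y - q) (by omega)
      simp only [c1, c2, c3, if_true, if_false, shift]
      split_ifs <;> omega
    by_cases c3 : y < p - 1 + C.n
    · have c4 : y + 1 - C.n < p := by omega
      have := hne (y + 1 - C.n) (by omega) (by omega)
      simp only [c1, c2, c3, c4, if_true, if_false, shift]
      split_ifs <;> omega
    by_cases c5 : y < p - 1 + C.n + B.n
    · have c4 : ¬ y + 1 - C.n < p := by omega
      have c6 : y + 1 - C.n < p + B.n := by omega
      have e : y + 1 - C.n - p = y - (p - 1 + C.n) := by omega
      simp only [c1, c2, c3, c4, c5, c6, e, if_true, if_false, shift]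
      split_ifs <;> omega
    · have c4 : ¬ y + 1 - C.n < p := by omega
      have c6 : ¬ y + 1 - C.n < p + B.n := by omega
      have c7 : ¬ y + 1 - B.n < q := by omega
      have c8 : ¬ y + 1 - B.n < q + C.n := by omega
      have e : y + 1 - C.n + 1 - B.n = y + 1 - B.n + 1 - C.n := by omega
      have := hne (y + 1 - B.n + 1 - C.n) (by omega) (by omega)
      simp only [c1, c2, c3, c4, c5, c6, c7, c8, e, if_false, shift]
      split_ifs <;> omega

/-- The pairs of left ends of crossing arcs. -/
def crossings (A : Invol) : Finset (ℕ × ℕ) :=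
  (Finset.range A.n ×ˢ Finset.range A.n).filter fun x =>
    x.1 < x.2 ∧ x.2 < A.f x.1 ∧ A.f x.1 < A.f x.2

theorem mem_crossings {A : Invol} {a b : ℕ} :
    (a, b) ∈ A.crossings ↔ b < A.n ∧ a < b ∧ b < A.f a ∧ A.f a < A.f b := by
  simp only [crossings, Finset.mem_filter, Finset.mem_product, Finset.mem_range]
  constructor
  · rintro ⟨⟨_, h⟩, h'⟩; exact ⟨h, h'⟩
  · rintro ⟨h, h'⟩; exact ⟨⟨by omega, h⟩, h'⟩

/-- Crossing arcs with left ends `a < b` give the occurrence of 3412 at `a`, `b`, `A.f a`, `A.f b`.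
-/
theorem card_crossings_le_stat (D : ℕ) (A : Invol) : A.crossings.card ≤ stat D A := by
  refine le_trans ?_ (Nat.le_add_right _ _)
  rw [crossings, Finset.card_filter, Finset.sum_product]
  refine Finset.sum_le_sum fun a ha => Finset.sum_le_sum fun b hb => ?_
  split_ifs with h
  · rw [Finset.mem_range] at ha hb
    have h1 := Finset.single_le_sum (f := fun k => ∑ l ∈ Finset.range A.n, A.occ4 a b k l)
      (fun _ _ => Nat.zero_le _) (Finset.mem_range.2 (A.f_lt ha))
    have h2 := Finset.single_le_sum (f := fun l => A.occ4 a b (A.f a) l)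
      (fun _ _ => Nat.zero_le _) (Finset.mem_range.2 (A.f_lt hb))
    have h3 : A.occ4 a b (A.f a) (A.f b) = 1 := by
      rw [occ4, if_pos]
      rw [A.invol, A.invol]
      exact ⟨h.1, h.2.1, h.2.2, h.1, h.2.1, h.2.2⟩
    omega
  · exact Nat.zero_le _

theorem card_crossings_infl {A : Invol} {p : ℕ} (hp : A.f p = p) (hn : p < A.n) (B : Invol) :
    A.crossings.card ≤ (A.infl p B).crossings.card := by
  refine Finset.card_le_card_of_injOn (fun x => (shift p B.n x.1, shift p B.n x.2)) ?_ ?_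
  · rintro ⟨a, b⟩ h
    rw [Finset.mem_coe, mem_crossings] at h ⊢
    have ha : a ≠ p := by rintro rfl; omega
    have hb : b ≠ p := by rintro rfl; omega
    rw [infl_shift hp hn B ha, infl_shift hp hn B hb, shift_lt_shift ha hb,
      shift_lt_shift hb (f_ne hp ha), shift_lt_shift (f_ne hp ha) (f_ne hp hb), infl_n hp hn]
    refine ⟨?_, h.2⟩
    unfold shift; split_ifs <;> omega
  · rintro ⟨a, b⟩ h ⟨a', b'⟩ h' he
    rw [Finset.mem_coe, mem_crossings] at h h'
    have ha : a ≠ p := by rintro rfl; omega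
    have hb : b ≠ p := by rintro rfl; omega
    have ha' : a' ≠ p := by rintro rfl; omega
    have hb' : b' ≠ p := by rintro rfl; omega
    simp only [Prod.mk.injEq, shift] at he ⊢
    split_ifs at he <;> omega

/-- Tuples of `j` involutions. -/
def Tup : ℕ → Type
  | 0 => Unit
  | j + 1 => Invol × Tup j

instance Tup.graded : (j : ℕ) → Graded (Tup j)
  | 0 => inferInstanceAs (Graded Unit)
  | j + 1 => letI := Tup.graded j; inferInstanceAs (Graded (Invol × Tup j))

/-- Replace the fixed points `2j - 1, …, 3, 1` by the involutions of a tuple. -/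
def inflAll : (j : ℕ) → Invol → Tup j → Invol
  | 0, A, _ => A
  | j + 1, A, τ => inflAll j (A.infl (2 * j + 1) τ.1) τ.2

/-- The points `1, 3, …, 2j - 1` are fixed. -/
def Marked (j : ℕ) (A : Invol) : Prop := ∀ i < j, A.f (2 * i + 1) = 2 * i + 1 ∧ 2 * i + 1 < A.n

theorem Marked.infl {j : ℕ} {A : Invol} (h : Marked j A) {p : ℕ} (hp : A.f p = p) (hn : p < A.n)
    (hj : 2 * j ≤ p) (B : Invol) : Marked j (A.infl p B) := fun i hi =>
  ⟨infl_fixed_lt hp hn B (h i hi).1 (by omega), by rw [infl_n hp hn]; omega⟩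

theorem Marked.of_le {j j' : ℕ} {A : Invol} (h : Marked j A) (hj : j' ≤ j) : Marked j' A :=
  fun i hi => h i (hi.trans_le hj)

theorem card_crossings_inflAll {j : ℕ} {A : Invol} (h : Marked j A) (τ : Tup j) :
    A.crossings.card ≤ (inflAll j A τ).crossings.card := by
  induction j generalizing A with
  | zero => exact le_rfl
  | succ j ih =>
    obtain ⟨h1, h2⟩ := h j (by omega)
    exact (card_crossings_infl h1 h2 τ.1).trans
      (ih ((h.of_le (by omega)).infl h1 h2 (by omega) _) τ.2)

/-- Inflations at different fixed points commute and do not change the cover of `p`. So the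
inflation at `p` can be carried out last, where `stat_infl` applies. -/
theorem stat_inflAll_infl (D : ℕ) {j : ℕ} {A : Invol} (h : Marked j A) {p : ℕ} (hp : A.f p = p)
    (hn : p < A.n) (hj : 2 * j ≤ p) (τ : Tup j) : ∃ a c, ∀ B : Invol,
    stat D (inflAll j (A.infl p B) τ) = a + c * B.n + stat (D + A.cover p) B := by
  induction j generalizing A p with
  | zero =>
    obtain ⟨a, c, -, h⟩ := stat_infl hp hn D
    exact ⟨a, c, h⟩
  | succ j ih =>
    obtain ⟨h1, h2⟩ := h j (by omega)
    have h3 : 2 * j + 1 < p := by omega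
    obtain ⟨a, c, h4⟩ := ih (A := A.infl (2 * j + 1) τ.1) (p := p - 1 + τ.1.n)
      ((h.of_le (by omega)).infl h1 h2 (by omega) _) (infl_fixed_gt h1 h2 _ hp h3)
      (by rw [infl_n h1 h2]; omega) (by omega) τ.2
    refine ⟨a, c, fun B => ?_⟩
    rw [inflAll, infl_comm hp hn h1 h3, h4, cover_infl h1 h2 h3]

end Invol

/-! ### Unique decomposition and the bound on cores -/

namespace Invol

/-- The interval `[a, b)` is mapped to itself. -/
def Closed (A : Invol) (a b : ℕ) : Prop := ∀ x, a ≤ x → x < b → a ≤ A.f x ∧ A.f x < b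

/-- The points `1, 3, …, 2j - 1` are fixed, and each is the longest invariant interval that
starts there. -/
def Stage (j : ℕ) (A : Invol) : Prop :=
  Marked j A ∧ ∀ i < j, ∀ b ≤ A.n, A.Closed (2 * i + 1) b → b ≤ 2 * i + 2

section

variable {A : Invol} {p : ℕ} (hp : A.f p = p) (hn : p < A.n) {B : Invol}

include hp hn

theorem Closed.of_infl_of_le {a b : ℕ} (hb : b ≤ p) (h : (A.infl p B).Closed a b) :
    A.Closed a b := fun x h1 h2 => by
  have h3 := h x h1 h2
  rw [infl_f hp hn, if_pos (by omega)] at h3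
  unfold shift at h3
  split_ifs at h3
  · exact h3
  · have := f_ne hp (x := x) (by omega)
    omega

/-- The maximum covers the case that `b` cuts through the block: the interval of `A` then ends right
after `p`. -/
theorem Closed.of_infl {a b : ℕ} (ha : a ≤ p) (hb : p < b) (h : (A.infl p B).Closed a b) :
    A.Closed a (max (p + 1) (b + 1 - B.n)) := fun x h1 h2 => by
  by_cases hx : x = p
  · subst hx; omega
  · have h4 := f_ne hp hx
    have h3 := h (shift p B.n x) (by unfold shift; split_ifs <;> omega)
      (by unfold shift; split_ifs <;> omega)
    rw [infl_shift hp hn B hx] at h3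
    unfold shift at h3
    split_ifs at h3 <;> omega

theorem Closed.infl_of_le {a b : ℕ} (hb : b ≤ p) (h : A.Closed a b) :
    (A.infl p B).Closed a b := fun x h1 h2 => by
  have h3 := h x h1 h2
  rw [infl_f hp hn, if_pos (by omega), shift, if_pos (by omega)]
  exact h3

theorem Closed.infl {a b : ℕ} (ha : a ≤ p) (hb : p < b) (h : A.Closed a b) :
    (A.infl p B).Closed a (b + B.n - 1) := fun x h1 h2 => by
  rw [infl_f hp hn]
  by_cases c1 : x < p
  · have := h x h1 (by omega)
    have := f_ne hp (x := x) (by omega)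
    rw [if_pos c1, shift]
    split_ifs <;> omega
  by_cases c2 : x < p + B.n
  · have := B.f_lt (x := x - p) (by omega)
    rw [if_neg c1, if_pos c2]
    omega
  · have := h (x + 1 - B.n) (by omega) (by omega)
    have := f_ne hp (x := x + 1 - B.n) (by omega)
    rw [if_neg c1, if_neg c2, shift]
    split_ifs <;> omega

end

/-- The restriction to an invariant interval. -/
def restr (A : Invol) {p b : ℕ} (h : A.Closed p b) : Invol where
  n := b - p
  f x := if x < b - p then A.f (x + p) - p else x
  invol x := by
    by_cases hx : x < b - p
    · have h1 := h (x + p) (by omega) (by omega)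
      have h2 : A.f (x + p) - p + p = A.f (x + p) := by omega
      have h3 : A.f (x + p) - p < b - p := by omega
      simp [hx, h2, h3, A.invol]
    · simp [hx]
  fix x hx := by simp; omega

/-- Replace the invariant interval `[p, b)` by a single fixed point. -/
def contract (A : Invol) {p b : ℕ} (hpb : p ≤ b) (hb : b ≤ A.n) (h : A.Closed p b) : Invol where
  n := A.n + 1 + p - b
  f x := if x = p then p else
    if A.f (if x < p then x else x + b - p - 1) < p
    then A.f (if x < p then x else x + b - p - 1)
    else A.f (if x < p then x else x + b - p - 1) + 1 + p - b
  invol x := by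
    have hc : ∀ y, (y < p ∨ b ≤ y) → A.f y < p ∨ b ≤ A.f y := fun y hy => by
      by_contra hcon
      have := h (A.f y) (by omega) (by omega)
      rw [A.invol] at this
      omega
    by_cases hx : x = p
    · simp [hx]
    · set y := if x < p then x else x + b - p - 1 with hy
      have hy' : y < p ∨ b ≤ y := by rw [hy]; split_ifs <;> omega
      rw [if_neg hx]
      rcases hc y hy' with h1 | h1
      · rw [if_pos h1, if_neg (by omega), if_pos h1, A.invol, hy]
        split_ifs <;> omega
      · have h2 : ¬ A.f y < p := by omega
        have h3 : A.f y + 1 + p - b + b - p - 1 = A.f y := by omega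
        rw [if_neg h2, if_neg (by omega), if_neg (c := A.f y + 1 + p - b < p) (by omega), h3,
          A.invol, hy]
        split_ifs <;> omega
  fix x hx := by
    have h1 : ¬ x < p := by omega
    have h2 := A.fix (x + b - p - 1) (by omega)
    simp only [h1, if_false, h2]
    split_ifs <;> omega

section

variable {A : Invol} {p b : ℕ} (hpb : p ≤ b) (hb : b ≤ A.n) (h : A.Closed p b)

theorem contract_fixed : (A.contract hpb hb h).f p = p := by simp [contract]

theorem lt_contract_n : p < (A.contract hpb hb h).n := by
  simp only [contract]; omega

theorem contract_infl_restr : (A.contract hpb hb h).infl p (A.restr h) = A := by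
  have e1 : (A.contract hpb hb h).n = A.n + 1 + p - b := rfl
  have e2 : (A.restr h).n = b - p := rfl
  have hc : ∀ y, (y < p ∨ b ≤ y) → A.f y < p ∨ b ≤ A.f y := fun y hy => by
    by_contra hcon
    have := h (A.f y) (by omega) (by omega)
    rw [A.invol] at this
    omega
  ext y
  · rw [infl_n (contract_fixed hpb hb h) (lt_contract_n hpb hb h)]
    omega
  · rw [infl_f (contract_fixed hpb hb h) (lt_contract_n hpb hb h), e2]
    by_cases c1 : y < p
    · have c2 := hc y (by omega)
      rw [if_pos c1]
      simp only [contract, c1, if_true, shift]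
      split_ifs <;> omega
    by_cases c3 : y < p + (b - p)
    · have h1 := h y (by omega) (by omega)
      rw [if_neg c1, if_pos c3]
      simp only [restr]
      rw [if_pos (by omega), Nat.sub_add_cancel (by omega)]
      omega
    · have c2 := hc y (by omega)
      have c4 : ¬ y + 1 - (b - p) < p := by omega
      have c5 : ¬ y + 1 - (b - p) = p := by omega
      have c6 : y + 1 - (b - p) + b - p - 1 = y := by omega
      rw [if_neg c1, if_neg c3]
      simp only [contract, c4, c5, c6, if_false, shift]
      split_ifs <;> omega

end

theorem exists_longest_closed (A : Invol) {p : ℕ} (hn : p ≤ A.n) :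
    ∃ b, p ≤ b ∧ b ≤ A.n ∧ A.Closed p b ∧ ∀ b' ≤ A.n, A.Closed p b' → b' ≤ b := by
  classical
  -- The empty interval is allowed; it corresponds to an empty block.
  have h0 : A.Closed p p := fun x h1 h2 => by omega
  exact ⟨Nat.findGreatest (A.Closed p) A.n, Nat.le_findGreatest hn h0, Nat.findGreatest_le _,
    Nat.findGreatest_spec hn h0, fun b' hb' h => Nat.le_findGreatest hb' h⟩

theorem Stage.infl {j : ℕ} {A : Invol} (h : Stage (j + 1) A) (B : Invol) :
    Stage j (A.infl (2 * j + 1) B) := by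
  obtain ⟨h1, h2⟩ := h.1 j (by omega)
  refine ⟨(h.1.of_le (by omega)).infl h1 h2 (by omega) B, fun i hi b hb hc => ?_⟩
  rw [infl_n h1 h2] at hb
  rcases le_or_gt b (2 * j + 1) with hbj | hbj
  · exact h.2 i (by omega) b (by omega) (hc.of_infl_of_le h1 h2 hbj)
  · have := h.2 i (by omega) _ (by omega) (hc.of_infl h1 h2 (by omega) hbj)
    omega

/-- If `B'` were larger, its block would be an invariant interval that pulls back to one in `A`
starting at `2 * j + 1` and longer than a single point. -/
theorem size_le_of_infl_eq {j : ℕ} {A A' B B' : Invol} (h : Stage (j + 1) A)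
    (h' : Stage (j + 1) A') (he : A.infl (2 * j + 1) B = A'.infl (2 * j + 1) B') :
    B'.n ≤ B.n := by
  obtain ⟨h1, h2⟩ := h.1 j (by omega)
  obtain ⟨h1', h2'⟩ := h'.1 j (by omega)
  by_contra hlt
  have hc : (A'.infl (2 * j + 1) B').Closed (2 * j + 1) (2 * j + 1 + B'.n) := fun x hx hx' => by
    have h3 := B'.f_lt (x := x - (2 * j + 1)) (by omega)
    rw [infl_f h1' h2', if_neg (by omega), if_pos hx']
    omega
  rw [← he] at hc
  have h4 := congrArg Invol.n he
  rw [infl_n h1 h2, infl_n h1' h2'] at h4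
  have := h.2 j (by omega) _ (by omega) (hc.of_infl h1 h2 le_rfl (by omega))
  omega

/-- The block is recovered as the longest invariant interval starting at `2 * j + 1`, and collapsing
it gives the stage `j + 1` involution. Collapsing also preserves maximality at the earlier marked
points. -/
theorem infl_bijOn (j : ℕ) : Set.BijOn (fun x : Invol × Invol => x.1.infl (2 * j + 1) x.2)
    {x | Stage (j + 1) x.1} {A | Stage j A ∧ 2 * j + 1 ≤ A.n} := by
  refine ⟨?_, ?_, ?_⟩
  · rintro ⟨A, B⟩ h
    obtain ⟨h1, h2⟩ := h.1 j (by omega)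
    refine ⟨h.infl B, ?_⟩
    have h3 := infl_n h1 h2 B
    have h4 : 2 * j + 1 < A.n := h2
    change 2 * j + 1 ≤ (A.infl (2 * j + 1) B).n
    rw [h3]
    omega
  · rintro ⟨A, B⟩ h ⟨A', B'⟩ h' he
    simp only [Set.mem_ofPred_eq] at h h' he
    have hm : B.n = B'.n := le_antisymm (size_le_of_infl_eq h' h he.symm)
      (size_le_of_infl_eq h h' he)
    obtain ⟨h1, h2⟩ := h.1 j (by omega)
    obtain ⟨h1', h2'⟩ := h'.1 j (by omega)
    have h4 := congrArg Invol.n he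
    rw [infl_n h1 h2, infl_n h1' h2'] at h4
    rw [Prod.mk.injEq]
    constructor
    · ext x
      · omega
      · by_cases hx : x = 2 * j + 1
        · rw [hx, h1, h1']
        · have h5 := infl_shift h1 h2 B hx
          have h6 := infl_shift h1' h2' B' hx
          rw [he, hm, h6] at h5
          have h7 := f_ne h1 hx
          have h8 := f_ne h1' hx
          unfold shift at h5
          split_ifs at h5 <;> omega
    · ext x
      · exact hm
      · by_cases hx : x < B.n
        · have h5 := infl_block h1 h2 B hx
          have h6 := infl_block h1' h2' B' (hm ▸ hx)
          rw [he, h6] at h5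
          omega
        · rw [B.fix x (by omega), B'.fix x (by omega)]
  · rintro A ⟨h, hn⟩
    obtain ⟨b, hpb, hb, hc, hmax⟩ := A.exists_longest_closed hn
    have h1 := contract_fixed hpb hb hc
    have h2 := lt_contract_n hpb hb hc
    have h3 := contract_infl_restr hpb hb hc
    have e1 : (A.contract hpb hb hc).n = A.n + 1 + (2 * j + 1) - b := rfl
    have e2 : (A.restr hc).n = b - (2 * j + 1) := rfl
    refine ⟨(A.contract hpb hb hc, A.restr hc), ⟨fun i hi => ?_, fun i hi d hd hcd => ?_⟩, h3⟩
    · rcases Nat.lt_succ_iff_lt_or_eq.1 hi with hij | rfl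
      · have h4 := (h.1 i hij).1
        have h5 : 2 * i + 1 < 2 * j + 1 := by omega
        refine ⟨?_, h5.trans h2⟩
        simp only [contract, h5, h4, if_true]
        split_ifs <;> omega
      · exact ⟨h1, h2⟩
    · simp only at hd hcd
      rcases le_or_gt d (2 * j + 1) with hdj | hdj
      · rcases Nat.lt_succ_iff_lt_or_eq.1 hi with hij | rfl
        · have := hcd.infl_of_le h1 h2 (B := A.restr hc) hdj
          rw [h3] at this
          exact h.2 i hij d (by omega) this
        · omega
      · have h4 := hcd.infl h1 h2 (B := A.restr hc) (by omega) hdj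
        rw [h3] at h4
        rcases Nat.lt_succ_iff_lt_or_eq.1 hi with hij | rfl
        · have := h.2 i hij _ (by omega) h4
          omega
        · have := hmax _ (by omega) h4
          omega

theorem Stage.exists_crossing {j : ℕ} {A : Invol} (h : Stage j A) {k : ℕ} (hk : 1 ≤ k)
    (hkj : k < j) (hf : 2 * k ≤ A.f (2 * k)) :
    ∃ x ∈ A.crossings, 2 * k = x.1 ∨ 2 * k = x.2 := by
  by_contra! hcon
  have hlt := (h.1 k hkj).2
  have hlt' := A.f_lt (x := 2 * k) (by omega)
  -- If the arc at `2 * k` crosses nothing, the interval from the marked point `2 * k - 1` to `A.f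
  -- (2 * k)` is invariant, against the maximality at that marked point.
  have hc : A.Closed (2 * (k - 1) + 1) (A.f (2 * k) + 1) := fun z hz hz' => by
    by_cases h1 : z = 2 * (k - 1) + 1
    · rw [h1, (h.1 (k - 1) (by omega)).1]; omega
    have h2 := A.invol z
    have h3 := A.invol (2 * k)
    by_cases h4 : z = 2 * k
    · rw [h4]; omega
    by_cases h5 : z = A.f (2 * k)
    · rw [h5, h3]; omega
    have h6 : A.f z ≠ 2 * k := fun he => h5 (by rw [← he, h2])
    have h7 : A.f z ≠ A.f (2 * k) := fun he => h4 (A.f_inj.1 he)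
    constructor
    · by_contra hlo
      refine (hcon (A.f z, 2 * k) (mem_crossings.2 ?_)).2 rfl
      omega
    · by_contra hhi
      refine (hcon (2 * k, z) (mem_crossings.2 ?_)).1 rfl
      omega
  have := h.2 (k - 1) (by omega) _ (by omega) hc
  omega

/-- Each of 2, 4, …, `2j - 2` other than the partner of 0 is an end of a crossing arc: a left end or
fixed point by `exists_crossing`, a right end because its partner is even, odd points being fixed. A
crossing has four ends. -/
theorem Stage.le_crossings {j : ℕ} {A : Invol} (h : Stage j A) :
    j ≤ 4 * A.crossings.card + 2 := by
  classical
  set S : Finset ℕ := A.crossings.biUnion fun x => {x.1, x.2, A.f x.1, A.f x.2} with hS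
  have h1 : S.card ≤ A.crossings.card * 4 := Finset.card_biUnion_le_card_mul _ _ _ fun x _ =>
    Finset.card_le_four
  have h2 : ((Finset.Ico 1 j).filter fun i => 2 * i ≠ A.f 0).card ≤ S.card := by
    refine Finset.card_le_card_of_injOn (fun i => 2 * i) ?_ fun a _ b _ hab => by
      simp only at hab; omega
    intro i hi
    simp only [Finset.coe_filter, Finset.mem_Ico, Set.mem_ofPred_eq] at hi
    obtain ⟨⟨hi1, hij⟩, hi0⟩ := hi
    simp only [Finset.mem_coe, hS, Finset.mem_biUnion, Finset.mem_insert, Finset.mem_singleton]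
    have h2 := A.invol (2 * i)
    rcases le_or_gt (2 * i) (A.f (2 * i)) with hle | hlt
    · obtain ⟨x, hx, hx'⟩ := h.exists_crossing hi1 hij hle
      exact ⟨x, hx, by tauto⟩
    · obtain ⟨k, hk | hk⟩ : ∃ k, A.f (2 * i) = 2 * k ∨ A.f (2 * i) = 2 * k + 1 :=
        ⟨A.f (2 * i) / 2, by omega⟩
      · have hk0 : k ≠ 0 := by rintro rfl; rw [hk] at h2; exact hi0 h2.symm
        rw [hk] at h2
        obtain ⟨x, hx, hx'⟩ := h.exists_crossing (k := k) (by omega) (by omega) (by omega)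
        refine ⟨x, hx, ?_⟩
        rcases hx' with hx' | hx'
        · rw [← hx', h2]; tauto
        · rw [← hx', h2]; tauto
      · have := (h.1 k (by omega)).1
        rw [hk] at h2
        omega
  have h3 : j - 1 ≤ ((Finset.Ico 1 j).filter fun i => 2 * i ≠ A.f 0).card + 1 := by
    have h4 := Finset.card_filter_add_card_filter_not (s := Finset.Ico 1 j)
      (fun i => 2 * i ≠ A.f 0)
    have h5 : ((Finset.Ico 1 j).filter fun i => ¬ 2 * i ≠ A.f 0).card ≤ 1 := by
      refine Finset.card_le_one.2 fun a ha b hb => ?_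
      simp only [Finset.mem_filter, not_not] at ha hb
      omega
    rw [Nat.card_Ico] at h4
    omega
  omega

end Invol

/-! ### Cores with a crossing -/

namespace Invol

open Graded

/-- The involution that reverses `{0, …, N - 1}`. -/
def reversal (N : ℕ) : Invol where
  n := N
  f x := if x < N then N - 1 - x else x
  invol x := by split_ifs <;> omega
  fix x hx := if_neg (by omega)

/-- Reversals avoid both 12 and 3412. As blocks of any prescribed size and statistic 0 they serve to
read off the constants in `stat_infl`. -/
theorem stat_reversal (D N : ℕ) : stat D (reversal N) = 0 := by
  have h1 : ∀ i ∈ Finset.range N, ∀ j ∈ Finset.range N, (reversal N).occ2 i j = 0 :=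
    fun i hi j hj => by
      rw [Finset.mem_range] at hi hj
      simp only [occ2, reversal, hi, hj, if_true]
      exact if_neg (by omega)
  have h2 : ∀ i ∈ Finset.range N, ∀ j ∈ Finset.range N, ∀ k ∈ Finset.range N,
      ∀ l ∈ Finset.range N, (reversal N).occ4 i j k l = 0 :=
    fun i hi j hj k hk l hl => by
      rw [Finset.mem_range] at hi hj hk hl
      simp only [occ4, reversal, hi, hj, hk, hl, if_true]
      exact if_neg (by omega)
  have h3 : ∑ i ∈ Finset.range N, ∑ j ∈ Finset.range N, (reversal N).occ2 i j = 0 :=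
    Finset.sum_eq_zero fun i hi => Finset.sum_eq_zero fun j hj => h1 i hi j hj
  rw [stat]
  change (∑ i ∈ Finset.range N, ∑ j ∈ Finset.range N, ∑ k ∈ Finset.range N,
    ∑ l ∈ Finset.range N, (reversal N).occ4 i j k l) +
      D * ∑ i ∈ Finset.range N, ∑ j ∈ Finset.range N, (reversal N).occ2 i j = 0
  rw [h3, sum_eq_zero_four h2, mul_zero, add_zero]

theorem eq_reversal_zero {A : Invol} (h : A.n = 0) : A = reversal 0 := by
  ext x
  · exact h
  · rw [A.fix x (by omega)]; rfl

/-- The generating function of the involutions with given value of `stat D`. -/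
noncomputable def statGF (D r : ℕ) : PowerSeries ℚ := gf {A : Invol | stat D A = r}

variable {s : PowerSeries ℚ}

theorem gf_stat_large_mem {D r : ℕ} (h : statGF D r ∈ ratSubalgebra s) (N : ℕ) :
    gf {A : Invol | stat D A = r ∧ ¬ A.n ≤ N} ∈ ratSubalgebra s := by
  have h1 := gf_split (fun A : Invol => A.n ≤ N) {A : Invol | stat D A = r}
  have h2 : gf {A | A ∈ {A : Invol | stat D A = r} ∧ A.n ≤ N} ∈ ratSubalgebra s :=
    gf_mem_of_finite s ((finite_size_le (α := Invol) N).subset fun A hA => hA.2)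
  have h3 := sub_mem h h2
  rw [statGF, h1, add_sub_cancel_left] at h3
  exact h3

/-- The statistic is `a + c * B.n + stat D' B` with `a`, `c` depending on the other blocks. Blocks
of size at most `r` are finitely many. A larger block forces `c = 0`, and then `a > 0` makes its
statistic smaller than `t`, so the induction hypothesis applies. -/
theorem gf_inflAll_mem {r : ℕ} (ih : ∀ D, ∀ ρ < r, statGF D ρ ∈ ratSubalgebra s) (D : ℕ) {j : ℕ}
    {A : Invol} (hA : Marked j A) (hc : 0 < A.crossings.card) {t : ℕ} (ht : t ≤ r) :
    gf {τ : Tup j | stat D (inflAll j A τ) = t} ∈ ratSubalgebra s := by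
  induction j generalizing A t with
  | zero => exact gf_mem_of_finite s ((Set.finite_univ (α := Unit)).subset (Set.subset_univ _))
  | succ j ihj =>
    obtain ⟨h1, h2⟩ := hA j (by omega)
    have hA' : Marked j A := hA.of_le (by omega)
    have hm : ∀ B, Marked j (A.infl (2 * j + 1) B) := fun B => hA'.infl h1 h2 (by omega) B
    have hpos : ∀ B, 0 < (A.infl (2 * j + 1) B).crossings.card := fun B =>
      hc.trans_le (card_crossings_infl h1 h2 B)
    -- `a` is the value at the empty block, where the crossing of `A` survives.
    have key : ∀ τ : Tup j, ∃ a c, 0 < a ∧ ∀ B : Invol,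
        stat D (inflAll j (A.infl (2 * j + 1) B) τ) =
          a + c * B.n + stat (D + A.cover (2 * j + 1)) B := fun τ => by
      obtain ⟨a, c, h⟩ := stat_inflAll_infl D hA' h1 h2 (by omega) τ
      refine ⟨a, c, ?_, h⟩
      have h3 := h (reversal 0)
      rw [stat_reversal] at h3
      have h4 := (hpos (reversal 0)).trans_le ((card_crossings_inflAll (hm (reversal 0)) τ).trans
        (card_crossings_le_stat D _))
      rw [h3] at h4
      simpa [reversal] using h4
    change gf (α := Invol × Tup j)
      {x | stat D (inflAll j (A.infl (2 * j + 1) x.1) x.2) = t} ∈ ratSubalgebra s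
    rw [gf_split (fun x : Invol × Tup j => x.1.n ≤ r)]
    refine add_mem ?_ ?_
    · refine gf_mem_of_fibers (fun x : Invol × Tup j => x.1) (finite_size_le (α := Invol) r) _
        (fun x hx => hx.2) fun B hB => ?_
      have h3 : {x : Invol × Tup j | x ∈ {x : Invol × Tup j | x ∈ {x : Invol × Tup j |
          stat D (inflAll j (A.infl (2 * j + 1) x.1) x.2) = t} ∧ x.1.n ≤ r} ∧ x.1 = B} =
          {B} ×ˢ {τ : Tup j | stat D (inflAll j (A.infl (2 * j + 1) B) τ) = t} := by
        ext ⟨C, τ⟩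
        constructor
        · rintro ⟨⟨h, _⟩, rfl⟩; exact ⟨rfl, h⟩
        · rintro ⟨h, h'⟩
          obtain rfl : C = B := h
          exact ⟨⟨h', hB⟩, rfl⟩
      rw [h3, gf_prod]
      exact mul_mem (gf_singleton_mem s B) (ihj (hm B) (hpos B) ht)
    · refine gf_mem_of_fibers (fun x : Invol × Tup j => stat (D + A.cover (2 * j + 1)) x.1)
        (Set.finite_Iio t) _ ?_ fun ρ hρ => ?_
      · rintro ⟨B, τ⟩ ⟨h, -⟩
        obtain ⟨a, c, ha, h3⟩ := key τ
        have h4 : stat D (inflAll j (A.infl (2 * j + 1) B) τ) = t := h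
        rw [h3] at h4
        simp only [Set.mem_Iio]
        omega
      -- Testing with a reversal of size `r + 1` expresses "`c = 0` and `a = t - ρ`" by one value:
      -- `a + c * (r + 1) = t - ρ ≤ r` forces `c = 0`. The set thereby becomes a product.
      · have h3 : {x : Invol × Tup j | x ∈ {x : Invol × Tup j | x ∈ {x : Invol × Tup j |
            stat D (inflAll j (A.infl (2 * j + 1) x.1) x.2) = t} ∧ ¬ x.1.n ≤ r} ∧
              stat (D + A.cover (2 * j + 1)) x.1 = ρ} =
            {B : Invol | stat (D + A.cover (2 * j + 1)) B = ρ ∧ ¬ B.n ≤ r} ×ˢ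
              {τ : Tup j | stat D (inflAll j (A.infl (2 * j + 1) (reversal (r + 1))) τ) =
                t - ρ} := by
          ext ⟨B, τ⟩
          obtain ⟨a, c, ha, h4⟩ := key τ
          have h5 := h4 B
          have h6 := h4 (reversal (r + 1))
          rw [stat_reversal] at h6
          have h7 : (reversal (r + 1)).n = r + 1 := rfl
          have h8 : ρ < t := hρ
          change ((stat D (inflAll j (A.infl (2 * j + 1) B) τ) = t ∧ ¬ B.n ≤ r) ∧
            stat (D + A.cover (2 * j + 1)) B = ρ) ↔
            (stat (D + A.cover (2 * j + 1)) B = ρ ∧ ¬ B.n ≤ r) ∧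
              stat D (inflAll j (A.infl (2 * j + 1) (reversal (r + 1))) τ) = t - ρ
          rw [h5, h6, h7]
          rcases Nat.eq_zero_or_pos c with rfl | hcp
          · omega
          · have h9 := Nat.le_mul_of_pos_left B.n hcp
            have h10 := Nat.le_mul_of_pos_left (r + 1) hcp
            omega
        rw [h3, gf_prod]
        exact mul_mem (gf_stat_large_mem (ih _ _ (lt_of_lt_of_le hρ ht)) r)
          (ihj (hm _) (hpos _) (by omega))

/-- The pairs of a stage `j` involution and a tuple that give an involution of statistic `r`. -/
def stagePairs (D r j : ℕ) : Set (Invol × Tup j) :=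
  {x | Stage j x.1 ∧ stat D (inflAll j x.1 x.2) = r}

theorem Stage.le_n {j : ℕ} {A : Invol} (h : Stage j A) : 2 * j ≤ A.n := by
  cases j with
  | zero => omega
  | succ j => have := (h.1 j (by omega)).2; omega

/-- Splitting off one more block turns it into a marked point of the core, which adds 1 to the total
size. -/
theorem gf_stagePairs_succ (D r j : ℕ) : gf (stagePairs D r (j + 1)) =
    PowerSeries.X * gf {x | x ∈ stagePairs D r j ∧ ¬ x.1.n = 2 * j} := by
  rw [← pow_one PowerSeries.X]
  have hb := infl_bijOn j
  have hs : ∀ (A : Invol), Stage (j + 1) A → A.f (2 * j + 1) = 2 * j + 1 ∧ 2 * j + 1 < A.n :=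
    fun A h => h.1 j (by omega)
  refine gf_bij (α := Invol × (Invol × Tup j)) 1 (stagePairs D r (j + 1)) _
    (fun x => (x.1.infl (2 * j + 1) x.2.1, x.2.2)) ⟨?_, ?_, ?_⟩ ?_ ?_
  · rintro ⟨A, B, τ⟩ h
    have h1 := hb.mapsTo (show (A, B) ∈ {x : Invol × Invol | Stage (j + 1) x.1} from h.1)
    simp only [Set.mem_ofPred_eq] at h1
    exact ⟨⟨h1.1, h.2⟩, by simp only; omega⟩
  · rintro ⟨A, B, τ⟩ h ⟨A', B', τ'⟩ h' he
    rw [Prod.mk.injEq] at he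
    have h1 := hb.injOn (show (A, B) ∈ {x : Invol × Invol | Stage (j + 1) x.1} from h.1)
      (show (A', B') ∈ {x : Invol × Invol | Stage (j + 1) x.1} from h'.1) he.1
    rw [Prod.mk.injEq] at h1
    obtain ⟨⟨rfl, rfl⟩, rfl : τ = τ'⟩ := And.intro h1 he.2
    rfl
  · rintro ⟨C, τ⟩ ⟨⟨h, h'⟩, hn⟩
    have h2 := h.le_n
    simp only at h h' hn h2
    obtain ⟨⟨A, B⟩, h3, h4⟩ := hb.surjOn (show C ∈ {A | Stage j A ∧ 2 * j + 1 ≤ A.n} from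
      ⟨h, by omega⟩)
    simp only at h4
    subst h4
    exact ⟨(A, B, τ), ⟨h3, h'⟩, rfl⟩
  · rintro ⟨A, B, τ⟩ h
    obtain ⟨h1, h2⟩ := hs A h.1
    have h3 := infl_n h1 h2 B
    change A.n + (B.n + size τ) = (A.infl (2 * j + 1) B).n + size τ + 1
    omega
  · rintro ⟨A, B, τ⟩ h
    obtain ⟨h1, h2⟩ := hs A h.1
    have h3 := arcs_infl h1 h2 B
    change (-1) ^ (A.infl (2 * j + 1) B).arcs * wt τ = (-1) ^ A.arcs * ((-1) ^ B.arcs * wt τ)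
    rw [h3, pow_add, mul_assoc]

theorem gf_stagePairs (D r j : ℕ) : PowerSeries.X * gf (stagePairs D r j) =
    PowerSeries.X * gf {x | x ∈ stagePairs D r j ∧ x.1.n = 2 * j} +
      gf (stagePairs D r (j + 1)) := by
  rw [gf_stagePairs_succ, gf_split (fun x : Invol × Tup j => x.1.n = 2 * j) (stagePairs D r j),
    mul_add]

theorem stagePairs_crossings {D r j : ℕ} {A : Invol} {τ : Tup j} (h : (A, τ) ∈ stagePairs D r j) :
    A.crossings.card ≤ r := by
  have h1 := card_crossings_inflAll h.1.1 τ
  have h2 := card_crossings_le_stat D (inflAll j A τ)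
  have h3 : stat D (inflAll j A τ) = r := h.2
  simp only at h1
  omega

theorem stagePairs_eq_empty {D r j : ℕ} (h : 4 * r + 2 < j) : stagePairs D r j = ∅ := by
  ext ⟨A, τ⟩
  simp only [Set.mem_empty_iff_false, iff_false]
  intro h1
  have h2 := stagePairs_crossings h1
  have h3 : j ≤ 4 * A.crossings.card + 2 := h1.1.le_crossings
  omega

theorem gf_stagePairs_mem {r : ℕ} (ih : ∀ D, ∀ ρ < r, statGF D ρ ∈ ratSubalgebra s) (D : ℕ)
    {j : ℕ} (hj : 3 ≤ j) : gf (stagePairs D r j) ∈ ratSubalgebra s := by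
  -- Descending induction on `j`, from the range where no stage `j` involution has few enough
  -- crossings.
  suffices H : ∀ k j, 3 ≤ j → 4 * r + 2 < j + k → gf (stagePairs D r j) ∈ ratSubalgebra s from
    H (4 * r + 3) j hj (by omega)
  intro k
  induction k with
  | zero =>
    intro j _ h
    rw [stagePairs_eq_empty (by omega), gf_empty]
    exact zero_mem _
  | succ k ihk =>
    intro j hj h
    refine ratSubalgebra.of_mul_mem PowerSeries.X_ne_zero ratSubalgebra.X_mem ?_
    rw [gf_stagePairs]
    refine add_mem (mul_mem ratSubalgebra.X_mem ?_) (ihk (j + 1) (by omega) (by omega))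
    refine gf_mem_of_fibers (fun x : Invol × Tup j => x.1)
      (I := {A : Invol | Stage j A ∧ A.n = 2 * j}) ?_ _ (fun x hx => ⟨hx.1.1, hx.2⟩) fun A hA => ?_
    · exact (finite_fiber (α := Invol) (2 * j)).subset fun A hA => hA.2
    · have h3 : {x : Invol × Tup j | x ∈ {x | x ∈ stagePairs D r j ∧ x.1.n = 2 * j} ∧ x.1 = A} =
          {A} ×ˢ {τ : Tup j | stat D (inflAll j A τ) = r} := by
        ext ⟨C, τ⟩
        constructor
        · rintro ⟨⟨h, _⟩, rfl⟩; exact ⟨rfl, h.2⟩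
        · rintro ⟨h, h'⟩
          obtain rfl : C = A := h
          exact ⟨⟨⟨hA.1, h'⟩, hA.2⟩, rfl⟩
      rw [h3, gf_prod]
      have h4 := hA.1.le_crossings
      exact mul_mem (gf_singleton_mem s A) (gf_inflAll_mem ih D hA.1.1 (by omega) le_rfl)

end Invol

/-! ### Crossing-free cores and the functional equation -/

namespace Invol

open Graded

/-- The identity of `{0, 1}`. -/
def idTwo : Invol where
  n := 2
  f x := x
  invol _ := rfl
  fix _ _ := rfl

/-- The involution of `{0, 1, 2, 3}` that exchanges `0` and `2`. -/
def arcPoint : Invol where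
  n := 4
  f x := if x = 0 then 2 else if x = 2 then 0 else x
  invol x := by
    by_cases h0 : x = 0
    · simp [h0]
    · by_cases h2 : x = 2 <;> simp [h0, h2]
  fix x hx := by split_ifs <;> omega

theorem stage_one_iff {A : Invol} : Stage 1 A ∧ A.n = 2 ↔ A = idTwo := by
  constructor
  · rintro ⟨h, hn⟩
    have h1 := (h.1 0 (by omega)).1
    simp only [mul_zero, zero_add] at h1
    ext x
    · exact hn
    · change A.f x = x
      rcases lt_or_ge x 2 with hx | hx
      · have h0 := A.f_lt (x := 0) (by omega)
        have h2 := f_ne h1 (x := 0) (by omega)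
        interval_cases x <;> omega
      · exact A.fix x (by omega)
  · rintro rfl
    refine ⟨⟨fun i hi => ?_, fun i hi b hb _ => ?_⟩, rfl⟩
    · obtain rfl : i = 0 := by omega
      exact ⟨rfl, by decide⟩
    · have : b ≤ 2 := hb
      omega

theorem stage_two_iff {A : Invol} : Stage 2 A ∧ A.n = 4 ↔ A = arcPoint := by
  constructor
  · rintro ⟨h, hn⟩
    have h1 := (h.1 0 (by omega)).1
    have h3 := (h.1 1 (by omega)).1
    simp only [mul_zero, zero_add, mul_one] at h1 h3
    norm_num at h3
    have h0 := A.f_lt (x := 0) (by omega)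
    have h01 := f_ne h1 (x := 0) (by omega)
    have h03 := f_ne h3 (x := 0) (by omega)
    have h00 := A.invol 0
    have h02 : A.f 0 = 2 := by
      by_contra hne
      have e0 : A.f 0 = 0 := by omega
      have e1 := f_ne h1 (x := 2) (by omega)
      have e2 := f_ne h3 (x := 2) (by omega)
      have e3 := f_ne e0 (x := 2) (by omega)
      have e4 := A.f_lt (x := 2) (by omega)
      -- If 0 is fixed, so is 2, and the invariant interval `[1, 3)` contradicts maximality at 1.
      have := h.2 0 (by omega) 3 (by omega) fun x hx hx' => by
        interval_cases x <;> omega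
      omega
    rw [h02] at h00
    ext x
    · exact hn
    · rcases lt_or_ge x 4 with hx | hx
      · interval_cases x <;> simp [arcPoint, h00, h1, h3, h02]
      · rw [A.fix x (by omega), arcPoint.fix x hx]
  · rintro rfl
    refine ⟨⟨fun i hi => ?_, fun i hi b hb hc => ?_⟩, rfl⟩
    · interval_cases i <;> decide
    · have hb : b ≤ 4 := hb
      by_contra hlt
      obtain rfl : i = 0 := by omega
      have := (hc 2 (by omega) (by omega)).1
      simp [arcPoint] at this

/-- Reduces a vanishing for all `D` to one that can be decided. -/
theorem stat_eq_zero {A : Invol} (h : stat 1 A = 0) (D : ℕ) : stat D A = 0 := by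
  rw [stat] at h ⊢
  rw [one_mul, Nat.add_eq_zero_iff] at h
  rw [h.1, h.2, mul_zero, add_zero]

/-- The blocks of sizes 0 and 1 determine the two constants of `stat_infl`. -/
theorem stat_infl_eq {A : Invol} {p : ℕ} (hp : A.f p = p) (hn : p < A.n) {D : ℕ}
    (hc : A.cover p = 0) (h0 : stat D (A.infl p (reversal 0)) = 0)
    (h1 : stat D (A.infl p (reversal 1)) = 0) (B : Invol) : stat D (A.infl p B) = stat D B := by
  obtain ⟨a, c, -, h⟩ := stat_infl hp hn D
  have e0 := h (reversal 0)
  have e1 := h (reversal 1)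
  have n0 : (reversal 0).n = 0 := rfl
  have n1 : (reversal 1).n = 1 := rfl
  rw [h0, stat_reversal, n0] at e0
  rw [h1, stat_reversal, n1] at e1
  have ha : a = 0 := by omega
  have hc0 : c = 0 := by omega
  rw [h, hc, ha, hc0, add_zero, zero_mul, zero_add, zero_add]

theorem stat_idTwo (B : Invol) : stat 0 (idTwo.infl 1 B) = stat 0 B :=
  stat_infl_eq rfl (by decide) (by decide) (by decide) (by decide) B

theorem le_stat_infl {A : Invol} {p : ℕ} (hp : A.f p = p) (hn : p < A.n) {D : ℕ} (hD : 0 < D)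
    (h : ∃ i < A.n, i < p ∧ A.f i < p ∨ p < i ∧ p < A.f i) (B : Invol) :
    B.n ≤ stat D (A.infl p B) := by
  obtain ⟨a, c, hc, he⟩ := stat_infl hp hn D
  have := Nat.le_mul_of_pos_left B.n (hD.trans_le (hc h))
  rw [he]
  omega

theorem stat_arcPoint_of_empty (D : ℕ) (C : Invol) :
    stat D ((arcPoint.infl 3 (reversal 0)).infl 1 C) = stat D C := by
  refine stat_infl_eq ?_ ?_ ?_ (stat_eq_zero ?_ D) (stat_eq_zero ?_ D) C <;> decide

/-- With `C` fixed, the statistic is affine in `B.n` plus `stat 0 B`; blocks of sizes 0 and 1 at the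
point 3 give the constant `stat 0 C` and slope 0. -/
theorem stat_arcPoint (B C : Invol) :
    stat 0 ((arcPoint.infl 3 B).infl 1 C) = stat 0 B + stat 0 C := by
  obtain ⟨a, c, h⟩ := stat_inflAll_infl 0 (j := 1) (A := arcPoint) (p := 3)
    (fun i hi => by interval_cases i; decide) rfl (by decide) (by decide) (C, ())
  have hc : arcPoint.cover 3 = 0 := by decide
  have n0 : (reversal 0).n = 0 := rfl
  have n1 : (reversal 1).n = 1 := rfl
  have e0 : stat 0 ((arcPoint.infl 3 (reversal 0)).infl 1 C) = _ := h (reversal 0)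
  have e1 : stat 0 ((arcPoint.infl 3 (reversal 1)).infl 1 C) = _ := h (reversal 1)
  have e2 : stat 0 ((arcPoint.infl 3 B).infl 1 C) = _ := h B
  rw [stat_arcPoint_of_empty, stat_reversal, n0] at e0
  have e3 : stat 0 ((arcPoint.infl 3 (reversal 1)).infl 1 C) = stat 0 C := by
    refine stat_infl_eq ?_ ?_ ?_ ?_ ?_ C <;> decide
  rw [e3, stat_reversal, n1] at e1
  have hc0 : c = 0 := by omega
  rw [e2, hc, hc0, zero_mul, zero_add, add_zero]
  omega

/-- The point 0 forms a 12 with every point of `B`, and the first position of the nonempty block `B`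
forms one with every point of `C`. -/
theorem le_stat_arcPoint {D : ℕ} (hD : 0 < D) (B C : Invol) (hB : B.n ≠ 0) :
    B.n ≤ stat D ((arcPoint.infl 3 B).infl 1 C) ∧
      C.n ≤ stat D ((arcPoint.infl 3 B).infl 1 C) := by
  have h1 : arcPoint.f 1 = 1 := rfl
  have h1n : 1 < arcPoint.n := by decide
  have h3 : arcPoint.f 3 = 3 := rfl
  have h3n : 3 < arcPoint.n := by decide
  have n4 : arcPoint.n = 4 := rfl
  constructor
  · rw [infl_comm h3 h3n h1 (by omega)]
    refine le_stat_infl (infl_fixed_gt h1 h1n C h3 (by omega)) ?_ hD ⟨0, ?_, ?_⟩ B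
    · rw [infl_n h1 h1n]; omega
    · rw [infl_n h1 h1n]; omega
    · left
      rw [infl_f h1 h1n]
      have : arcPoint.f 0 = 2 := rfl
      simp only [this, shift]
      split_ifs <;> omega
  · refine le_stat_infl (infl_fixed_lt h3 h3n B h1 (by omega)) ?_ hD ⟨3, ?_, ?_⟩ C
    · rw [infl_n h3 h3n]; omega
    · rw [infl_n h3 h3n]; omega
    · right
      have := infl_block h3 h3n B (z := 0) (by omega)
      rw [add_zero] at this
      omega

theorem gf_stage_zero (D r : ℕ) :
    gf {x | x ∈ stagePairs D r 0 ∧ x.1.n = 2 * 0} = if r = 0 then 1 else 0 := by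
  split_ifs with hr
  · have h : {x : Invol × Tup 0 | x ∈ stagePairs D r 0 ∧ x.1.n = 2 * 0} =
        {((reversal 0, ()) : Invol × Unit)} := by
      ext ⟨A, τ⟩
      constructor
      · rintro ⟨-, h⟩
        obtain rfl := eq_reversal_zero h
        rfl
      · intro h
        obtain ⟨rfl, -⟩ := Prod.mk.inj (show (A, τ) = ((reversal 0, ()) : Invol × Unit) from h)
        refine ⟨⟨⟨fun i hi => by omega, fun i hi => by omega⟩, ?_⟩, rfl⟩
        rw [hr]
        exact stat_reversal D 0
    rw [h]
    refine (gf_singleton (α := Invol × Unit) (reversal 0, ())).trans ?_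
    have h1 : size ((reversal 0, ()) : Invol × Unit) = 0 := rfl
    have h2 : wt ((reversal 0, ()) : Invol × Unit) = 1 := by
      change (-1 : ℚ) ^ (reversal 0).arcs * 1 = 1
      have : (reversal 0).arcs = 0 := rfl
      rw [this]; norm_num
    rw [h1, h2]
    simp
  · have h : {x : Invol × Tup 0 | x ∈ stagePairs D r 0 ∧ x.1.n = 2 * 0} = ∅ := by
      ext ⟨A, τ⟩
      simp only [Set.mem_empty_iff_false, iff_false]
      rintro ⟨h1, h⟩
      obtain rfl := eq_reversal_zero h
      have h2 : stat D (reversal 0) = r := h1.2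
      rw [stat_reversal] at h2
      exact hr h2.symm
    rw [h, gf_empty]

theorem gf_stagePairs_zero (D r : ℕ) : gf (stagePairs D r 0) = statGF D r := by
  rw [statGF, ← one_mul (gf {A : Invol | stat D A = r}), ← pow_zero PowerSeries.X]
  refine gf_bij (α := Invol × Unit) 0 (stagePairs D r 0) _ (fun x => x.1) ⟨?_, ?_, ?_⟩ ?_ ?_
  · rintro ⟨A, τ⟩ h; exact h.2
  · rintro ⟨A, τ⟩ _ ⟨A', τ'⟩ _ he
    obtain rfl : A = A' := he
    rfl
  · intro A h
    exact ⟨(A, ()), ⟨⟨fun i hi => by omega, fun i hi => by omega⟩, h⟩, rfl⟩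
  · intro x _; rfl
  · intro x _; exact (mul_one _).symm

theorem gf_stage_one (D r : ℕ) : gf {x | x ∈ stagePairs D r 1 ∧ x.1.n = 2 * 1} =
    PowerSeries.X ^ 2 * gf {B : Invol | stat D (idTwo.infl 1 B) = r} := by
  have h : {x : Invol × Tup 1 | x ∈ stagePairs D r 1 ∧ x.1.n = 2 * 1} =
      {idTwo} ×ˢ {τ : Tup 1 | stat D (inflAll 1 idTwo τ) = r} := by
    ext ⟨A, τ⟩
    constructor
    · rintro ⟨h, h'⟩
      obtain rfl := stage_one_iff.1 ⟨h.1, h'⟩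
      exact ⟨rfl, h.2⟩
    · rintro ⟨h, h'⟩
      obtain rfl : A = idTwo := h
      exact ⟨⟨(stage_one_iff.2 rfl).1, h'⟩, rfl⟩
  rw [h, gf_prod, gf_singleton]
  have h1 : size idTwo = 2 := rfl
  have h2 : wt idTwo = 1 := by
    change (-1 : ℚ) ^ idTwo.arcs = 1
    have : idTwo.arcs = 0 := by decide
    rw [this, pow_zero]
  have h3 : gf {τ : Tup 1 | stat D (inflAll 1 idTwo τ) = r} =
      gf {B : Invol | stat D (idTwo.infl 1 B) = r} := by
    rw [← one_mul (gf {B : Invol | stat D (idTwo.infl 1 B) = r}), ← pow_zero PowerSeries.X]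
    refine gf_bij (α := Invol × Unit) 0 _ _ (fun x => x.1) ⟨?_, ?_, ?_⟩ ?_ ?_
    · rintro ⟨A, τ⟩ h; exact h
    · rintro ⟨A, τ⟩ _ ⟨A', τ'⟩ _ he
      obtain rfl : A = A' := he
      rfl
    · intro A h
      exact ⟨(A, ()), h, rfl⟩
    · intro x _; rfl
    · intro x _; exact (mul_one _).symm
  rw [h1, h2, h3, map_one, one_mul]

theorem gf_stage_two (D r : ℕ) : gf {x | x ∈ stagePairs D r 2 ∧ x.1.n = 2 * 2} =
    - PowerSeries.X ^ 4 *
      gf {x : Invol × Invol | stat D ((arcPoint.infl 3 x.1).infl 1 x.2) = r} := by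
  have h : {x : Invol × Tup 2 | x ∈ stagePairs D r 2 ∧ x.1.n = 2 * 2} =
      {arcPoint} ×ˢ {τ : Tup 2 | stat D (inflAll 2 arcPoint τ) = r} := by
    ext ⟨A, τ⟩
    constructor
    · rintro ⟨h, h'⟩
      obtain rfl := stage_two_iff.1 ⟨h.1, h'⟩
      exact ⟨rfl, h.2⟩
    · rintro ⟨h, h'⟩
      obtain rfl : A = arcPoint := h
      exact ⟨⟨(stage_two_iff.2 rfl).1, h'⟩, rfl⟩
  rw [h, gf_prod, gf_singleton]
  have h1 : size arcPoint = 4 := rfl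
  have h2 : wt arcPoint = -1 := by
    change (-1 : ℚ) ^ arcPoint.arcs = -1
    have : arcPoint.arcs = 1 := by decide
    rw [this, pow_one]
  have h3 : gf {τ : Tup 2 | stat D (inflAll 2 arcPoint τ) = r} =
      gf {x : Invol × Invol | stat D ((arcPoint.infl 3 x.1).infl 1 x.2) = r} := by
    rw [← one_mul (gf {x : Invol × Invol | stat D ((arcPoint.infl 3 x.1).infl 1 x.2) = r}),
      ← pow_zero PowerSeries.X]
    refine gf_bij (α := Invol × (Invol × Unit)) 0 _ _ (fun x => (x.1, x.2.1)) ⟨?_, ?_, ?_⟩ ?_ ?_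
    · rintro ⟨A, B, τ⟩ h; exact h
    · rintro ⟨A, B, τ⟩ _ ⟨A', B', τ'⟩ _ he
      obtain ⟨rfl, rfl⟩ := Prod.mk.inj he
      rfl
    · rintro ⟨A, B⟩ h
      exact ⟨(A, B, ()), h, rfl⟩
    · intro x _; rfl
    · rintro ⟨A, B, τ⟩ _
      change wt A * wt B = wt A * (wt B * 1)
      rw [mul_one]
  rw [h1, h2, h3, map_neg, map_one]
  ring

/-- The recursion `gf_stagePairs` telescoped over stages 0, 1, 2. Each stage costs one factor `X`,
which replaces subtracting the marked points from the size of the core. -/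
theorem statGF_eq (D r : ℕ) : PowerSeries.X ^ 3 * statGF D r =
    PowerSeries.X ^ 3 * (if r = 0 then 1 else 0) +
    PowerSeries.X ^ 4 * gf {B : Invol | stat D (idTwo.infl 1 B) = r} -
    PowerSeries.X ^ 5 *
      gf {x : Invol × Invol | stat D ((arcPoint.infl 3 x.1).infl 1 x.2) = r} +
    gf (stagePairs D r 3) := by
  have h0 := gf_stagePairs D r 0
  have h1 := gf_stagePairs D r 1
  have h2 := gf_stagePairs D r 2
  rw [gf_stage_zero, gf_stagePairs_zero] at h0
  rw [gf_stage_one] at h1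
  rw [gf_stage_two] at h2
  linear_combination PowerSeries.X ^ 2 * h0 + PowerSeries.X * h1 + h2

theorem gf_arcPoint (r : ℕ) :
    gf {x : Invol × Invol | stat 0 ((arcPoint.infl 3 x.1).infl 1 x.2) = r} =
      ∑ k ∈ Finset.HasAntidiagonal.antidiagonal r, statGF 0 k.1 * statGF 0 k.2 := by
  rw [gf_fiberwise (fun x : Invol × Invol => (stat 0 x.1, stat 0 x.2)) (Finset.HasAntidiagonal.antidiagonal r)]
  · refine Finset.sum_congr rfl fun k hk => ?_
    rw [statGF, statGF, ← gf_prod]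
    congr 1
    ext ⟨B, C⟩
    rw [Finset.HasAntidiagonal.mem_antidiagonal] at hk
    simp only [Set.mem_ofPred_eq, stat_arcPoint, Set.mem_prod, Prod.ext_iff]
    omega
  · rintro ⟨B, C⟩ h
    simp only [Set.mem_ofPred_eq, stat_arcPoint] at h
    simpa using h

theorem gf_idTwo (r : ℕ) : gf {B : Invol | stat 0 (idTwo.infl 1 B) = r} = statGF 0 r := by
  simp only [stat_idTwo, statGF]

theorem statGF_zero_zero : statGF 0 0 =
    1 + PowerSeries.X * statGF 0 0 - PowerSeries.X ^ 2 * statGF 0 0 ^ 2 := by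
  have h := statGF_eq 0 0
  have h3 : stagePairs 0 0 3 = ∅ := stagePairs_eq_empty (by omega)
  rw [gf_arcPoint, gf_idTwo, h3, gf_empty, if_pos rfl] at h
  simp only [Finset.Nat.antidiagonal_zero, Finset.sum_singleton] at h
  refine mul_left_cancel₀ (pow_ne_zero 3 PowerSeries.X_ne_zero) ?_
  rw [h]
  ring

variable {s : PowerSeries ℚ}

/-- For `D > 0` the point 0 of `idTwo` bounds the block, leaving finitely many. With `arcPoint` the
same holds unless the block at 3 is empty, and that case reproduces the unknown series, giving the
coefficient `1 + X ^ 2`. -/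
theorem statGF_mem_of_pos {r : ℕ} (ih : ∀ D, ∀ ρ < r, statGF D ρ ∈ ratSubalgebra s) {D : ℕ}
    (hD : 0 < D) : statGF D r ∈ ratSubalgebra s := by
  have h1 : gf {B : Invol | stat D (idTwo.infl 1 B) = r} ∈ ratSubalgebra s := by
    refine gf_mem_of_finite s ((finite_size_le (α := Invol) r).subset fun B hB => ?_)
    have := le_stat_infl (A := idTwo) (p := 1) rfl (by decide) hD
      ⟨0, by decide, Or.inl ⟨by decide, by decide⟩⟩ B
    change B.n ≤ r
    rwa [show stat D (idTwo.infl 1 B) = r from hB] at this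
  have h2 : gf {x : Invol × Invol | stat D ((arcPoint.infl 3 x.1).infl 1 x.2) = r} -
      statGF D r ∈ ratSubalgebra s := by
    rw [gf_split (fun x : Invol × Invol => x.1.n = 0)]
    have h3 : {x : Invol × Invol | x ∈ {x : Invol × Invol |
        stat D ((arcPoint.infl 3 x.1).infl 1 x.2) = r} ∧ x.1.n = 0} =
        {reversal 0} ×ˢ {C : Invol | stat D C = r} := by
      ext ⟨B, C⟩
      constructor
      · rintro ⟨h, h'⟩
        obtain rfl := eq_reversal_zero h'
        refine ⟨rfl, ?_⟩
        rwa [Set.mem_ofPred_eq, stat_arcPoint_of_empty] at h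
      · rintro ⟨h, h'⟩
        obtain rfl : B = reversal 0 := h
        refine ⟨?_, rfl⟩
        rwa [Set.mem_ofPred_eq, stat_arcPoint_of_empty]
    have h4 : gf {reversal 0} = 1 := by
      rw [gf_singleton]
      have h1 : size (reversal 0) = 0 := rfl
      have h2 : wt (reversal 0) = 1 := by
        change (-1 : ℚ) ^ (reversal 0).arcs = 1
        have : (reversal 0).arcs = 0 := rfl
        rw [this, pow_zero]
      rw [h1, h2, pow_zero, mul_one, map_one]
    rw [h3, gf_prod, h4, one_mul, ← statGF, add_sub_cancel_left]
    refine gf_mem_of_finite s (((finite_size_le (α := Invol) r).prod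
      (finite_size_le (α := Invol) r)).subset ?_)
    rintro ⟨B, C⟩ ⟨h, h'⟩
    have := le_stat_arcPoint hD B C h'
    rw [show stat D ((arcPoint.infl 3 B).infl 1 C) = r from h] at this
    exact this
  have h := statGF_eq D r
  have hX : (PowerSeries.X : PowerSeries ℚ) ∈ ratSubalgebra s := ratSubalgebra.X_mem
  have hne : (PowerSeries.X ^ 3 * (1 + PowerSeries.X ^ 2) : PowerSeries ℚ) ≠ 0 := by
    refine mul_ne_zero (pow_ne_zero 3 PowerSeries.X_ne_zero) fun h => ?_
    have := congrArg PowerSeries.constantCoeff h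
    simp at this
  refine ratSubalgebra.of_mul_mem hne (mul_mem (pow_mem hX 3) (add_mem (one_mem _) (pow_mem hX 2)))
    ?_
  have h5 : PowerSeries.X ^ 3 * (1 + PowerSeries.X ^ 2) * statGF D r =
      PowerSeries.X ^ 3 * (if r = 0 then 1 else 0) +
      PowerSeries.X ^ 4 * gf {B : Invol | stat D (idTwo.infl 1 B) = r} -
      PowerSeries.X ^ 5 * (gf {x : Invol × Invol |
        stat D ((arcPoint.infl 3 x.1).infl 1 x.2) = r} - statGF D r) +
      gf (stagePairs D r 3) := by
    linear_combination h
  rw [h5]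
  refine add_mem (sub_mem (add_mem (mul_mem (pow_mem hX 3) ?_) (mul_mem (pow_mem hX 4) h1))
    (mul_mem (pow_mem hX 5) h2)) (gf_stagePairs_mem ih D le_rfl)
  split_ifs
  · exact one_mem _
  · exact zero_mem _

theorem statGF_zero_mem (hs : s = 1 - PowerSeries.X + 2 * PowerSeries.X ^ 2 * statGF 0 0) {r : ℕ}
    (ih : ∀ D, ∀ ρ < r, statGF D ρ ∈ ratSubalgebra s) : statGF 0 r ∈ ratSubalgebra s := by
  have hX : (PowerSeries.X : PowerSeries ℚ) ∈ ratSubalgebra s := ratSubalgebra.X_mem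
  have h2 : (2 : PowerSeries ℚ) ∈ ratSubalgebra s := by
    rw [← one_add_one_eq_two]
    exact add_mem (one_mem _) (one_mem _)
  rcases Nat.eq_zero_or_pos r with rfl | hr
  · have hne : (2 * PowerSeries.X ^ 2 : PowerSeries ℚ) ≠ 0 :=
      mul_ne_zero (fun h => by
        have h1 := congrArg PowerSeries.constantCoeff (one_add_one_eq_two.trans h)
        rw [map_add, map_one, map_zero] at h1
        norm_num at h1) (pow_ne_zero 2 PowerSeries.X_ne_zero)
    refine ratSubalgebra.of_mul_mem hne (mul_mem h2 (pow_mem hX 2)) ?_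
    have h : 2 * PowerSeries.X ^ 2 * statGF 0 0 = s - 1 + PowerSeries.X := by
      rw [hs]; ring
    rw [h]
    exact add_mem (sub_mem ratSubalgebra.self_mem (one_mem _)) hX
  · have hs0 : s ≠ 0 := fun h => by
      have := congrArg PowerSeries.constantCoeff (hs.symm.trans h)
      simp at this
    refine ratSubalgebra.of_mul_mem (mul_ne_zero (pow_ne_zero 3 PowerSeries.X_ne_zero) hs0)
      (mul_mem (pow_mem hX 3) ratSubalgebra.self_mem) ?_
    have h := statGF_eq 0 r
    rw [gf_arcPoint, gf_idTwo, if_neg (by omega)] at h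
    -- The two end terms of the convolution contain the unknown `statGF 0 r`. Together with the
    -- `idTwo` term they make its coefficient `X ^ 3 * s`; the other terms fall under the induction
    -- hypothesis.
    have hsub : {(0, r), (r, 0)} ⊆ Finset.HasAntidiagonal.antidiagonal r := by
      intro k hk
      simp only [Finset.mem_insert, Finset.mem_singleton] at hk
      rw [Finset.HasAntidiagonal.mem_antidiagonal]
      rcases hk with rfl | rfl <;> simp
    rw [← Finset.sum_sdiff hsub, Finset.sum_pair (by simp; omega)] at h
    have h5 : PowerSeries.X ^ 3 * s * statGF 0 r = gf (stagePairs 0 r 3) -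
        PowerSeries.X ^ 5 * ∑ k ∈ Finset.HasAntidiagonal.antidiagonal r \ {(0, r), (r, 0)},
          statGF 0 k.1 * statGF 0 k.2 := by
      rw [hs]
      linear_combination h
    rw [h5]
    refine sub_mem (gf_stagePairs_mem ih 0 le_rfl) (mul_mem (pow_mem hX 5)
      (sum_mem fun k hk => ?_))
    obtain ⟨k₁, k₂⟩ := k
    simp only [Finset.mem_sdiff, Finset.HasAntidiagonal.mem_antidiagonal, Finset.mem_insert, Finset.mem_singleton,
      Prod.mk.injEq, not_or] at hk
    exact mul_mem (ih 0 _ (by simp only; omega)) (ih 0 _ (by simp only; omega))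

theorem statGF_mem (hs : s = 1 - PowerSeries.X + 2 * PowerSeries.X ^ 2 * statGF 0 0) (D r : ℕ) :
    statGF D r ∈ ratSubalgebra s := by
  induction r using Nat.strong_induction_on generalizing D with
  | _ r ih =>
    have ih' : ∀ D, ∀ ρ < r, statGF D ρ ∈ ratSubalgebra s := fun D ρ hρ => ih ρ hρ D
    rcases Nat.eq_zero_or_pos D with rfl | hD
    · exact statGF_zero_mem hs ih'
    · exact statGF_mem_of_pos ih' hD

end Invol

/-! ### From permutations to the statistic and the sign -/

namespace Invol

open Graded

theorem ofPerm_f {n : ℕ} (π : Equiv.Perm (Fin n)) (h : π⁻¹ = π) (x : Fin n) :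
    (ofPerm π h).f x = π x := by
  simp [ofPerm]

theorem occurrences_3412 {n : ℕ} (π : Equiv.Perm (Fin n)) (h : π⁻¹ = π) :
    occurrences ![3, 4, 1, 2] π = stat 0 (ofPerm π h) := by
  have h1 : stat 0 (ofPerm π h) = ∑ i : Fin n, ∑ j : Fin n, ∑ k : Fin n, ∑ l : Fin n,
      (ofPerm π h).occ4 i j k l := by
    rw [stat, zero_mul, add_zero]
    change ∑ i ∈ Finset.range n, ∑ j ∈ Finset.range n, ∑ k ∈ Finset.range n,
      ∑ l ∈ Finset.range n, (ofPerm π h).occ4 i j k l = _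
    simp only [Finset.sum_range]
  have h2 : (∑ i : Fin n, ∑ j : Fin n, ∑ k : Fin n, ∑ l : Fin n, (ofPerm π h).occ4 i j k l) =
      (Finset.univ.filter fun q : Fin n × Fin n × Fin n × Fin n =>
        q.1 < q.2.1 ∧ q.2.1 < q.2.2.1 ∧ q.2.2.1 < q.2.2.2 ∧ π q.2.2.1 < π q.2.2.2 ∧
          π q.2.2.2 < π q.1 ∧ π q.1 < π q.2.1).card := by
    rw [Finset.card_filter]
    simp only [Fintype.sum_prod_type, occ4, ofPerm_f, Fin.val_fin_lt]
  rw [h1, h2, occurrences]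
  have key : ∀ x : Fin 4 → Fin n, (StrictMono x ∧ ∀ a b : Fin 4, π (x a) < π (x b) ↔
      (![3, 4, 1, 2] : Fin 4 → ℕ) a < (![3, 4, 1, 2] : Fin 4 → ℕ) b) ↔
      x 0 < x 1 ∧ x 1 < x 2 ∧ x 2 < x 3 ∧ π (x 2) < π (x 3) ∧ π (x 3) < π (x 0) ∧
        π (x 0) < π (x 1) := by
    intro x
    constructor
    · rintro ⟨hm, ho⟩
      exact ⟨hm (by decide), hm (by decide), hm (by decide), (ho 2 3).2 (by decide),
        (ho 3 0).2 (by decide), (ho 0 1).2 (by decide)⟩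
    · rintro ⟨h1, h2, h3, h4, h5, h6⟩
      refine ⟨Fin.strictMono_iff_lt_succ.2 fun i => ?_, fun a b => ?_⟩
      · fin_cases i
        · exact h1
        · exact h2
        · exact h3
      · fin_cases a <;> fin_cases b <;> simp <;> omega
  refine Finset.card_bij' (fun x _ => (x 0, x 1, x 2, x 3))
    (fun q _ => ![q.1, q.2.1, q.2.2.1, q.2.2.2]) ?_ ?_ ?_ ?_
  · intro x hx
    rw [Finset.mem_filter, key] at hx
    simpa using hx.2
  · intro q hq
    rw [Finset.mem_filter] at hq
    rw [Finset.mem_filter, key]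
    exact ⟨Finset.mem_univ _, hq.2⟩
  · intro x _
    ext a
    fin_cases a <;> rfl
  · intro q _
    rfl

/-- The inversions. -/
def inversions (A : Invol) : Finset (ℕ × ℕ) :=
  (Finset.range A.n ×ˢ Finset.range A.n).filter fun x => x.1 < x.2 ∧ A.f x.2 < A.f x.1

theorem occurrences_21 {n : ℕ} (π : Equiv.Perm (Fin n)) (h : π⁻¹ = π) :
    occurrences ![2, 1] π = (ofPerm π h).inversions.card := by
  have key : ∀ x : Fin 2 → Fin n, (StrictMono x ∧ ∀ a b : Fin 2, π (x a) < π (x b) ↔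
      (![2, 1] : Fin 2 → ℕ) a < (![2, 1] : Fin 2 → ℕ) b) ↔ x 0 < x 1 ∧ π (x 1) < π (x 0) := by
    intro x
    constructor
    · rintro ⟨hm, ho⟩
      exact ⟨hm (by decide), (ho 1 0).2 (by decide)⟩
    · rintro ⟨h1, h2⟩
      refine ⟨Fin.strictMono_iff_lt_succ.2 fun i => ?_, fun a b => ?_⟩
      · fin_cases i
        exact h1
      · fin_cases a <;> fin_cases b <;> simp <;> omega
  rw [occurrences]
  refine Finset.card_bij (fun x _ => ((x 0 : ℕ), (x 1 : ℕ))) ?_ ?_ ?_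
  · intro x hx
    rw [Finset.mem_filter, key] at hx
    simp only [inversions, Finset.mem_filter, Finset.mem_product, Finset.mem_range, ofPerm_f,
      Fin.val_fin_lt]
    exact ⟨⟨(x 0).2, (x 1).2⟩, hx.2⟩
  · intro x _ y _ he
    simp only [Prod.mk.injEq, Fin.val_inj] at he
    ext a
    fin_cases a
    · exact congrArg Fin.val he.1
    · exact congrArg Fin.val he.2
  · rintro ⟨i, j⟩ hx
    simp only [inversions, Finset.mem_filter, Finset.mem_product, Finset.mem_range] at hx
    obtain ⟨⟨hi, hj⟩, hx⟩ := hx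
    refine ⟨![⟨i, hi⟩, ⟨j, hj⟩], ?_, rfl⟩
    have e1 := ofPerm_f π h ⟨i, hi⟩
    have e2 := ofPerm_f π h ⟨j, hj⟩
    simp only at e1 e2
    rw [Finset.mem_filter, key]
    rw [e1, e2] at hx
    exact ⟨Finset.mem_univ _, hx⟩

/-- The inversions `(i, j)` with `A.f i ≠ j` are paired off by `(i, j) ↦ (A.f j, A.f i)`; the others
are the two-cycles. -/
theorem neg_one_pow_card_inversions (A : Invol) :
    (-1 : ℚ) ^ A.inversions.card = (-1) ^ A.arcs := by
  have h1 : (A.inversions.filter fun x => A.f x.1 = x.2).card = A.arcs := by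
    rw [arcs, ← Finset.card_filter]
    refine (Finset.card_bij (fun i _ => (i, A.f i)) ?_ ?_ ?_).symm
    · intro i hi
      rw [Finset.mem_filter, Finset.mem_range] at hi
      simp only [inversions, Finset.mem_filter, Finset.mem_product, Finset.mem_range, A.invol]
      exact ⟨⟨⟨hi.1, A.f_lt hi.1⟩, hi.2, hi.2⟩, trivial⟩
    · intro i _ j _ he
      exact (Prod.mk.inj he).1
    · rintro ⟨i, j⟩ h
      simp only [inversions, Finset.mem_filter, Finset.mem_product, Finset.mem_range] at h
      obtain ⟨⟨⟨hi, hj⟩, hij, -⟩, rfl⟩ := h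
      exact ⟨i, by simp [hi, hij], rfl⟩
  have h2 : Even (A.inversions.filter fun x => ¬ A.f x.1 = x.2).card := by
    rw [← ZMod.natCast_eq_zero_iff_even, Finset.cast_card]
    refine Finset.sum_involution (fun x _ => (A.f x.2, A.f x.1)) ?_ ?_ ?_ ?_
    · intro _ _; decide
    · rintro ⟨i, j⟩ h _ he
      rw [Finset.mem_filter] at h
      exact h.2 (Prod.mk.inj he).2
    · rintro ⟨i, j⟩ h
      simp only [inversions, Finset.mem_filter, Finset.mem_product, Finset.mem_range,
        A.invol] at h ⊢
      exact ⟨⟨⟨A.f_lt h.1.1.2, A.f_lt h.1.1.1⟩, h.1.2.2, h.1.2.1⟩, fun he => h.2 he.symm⟩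
    · rintro ⟨i, j⟩ _
      simp only [A.invol]
  rw [← Finset.card_filter_add_card_filter_not (s := A.inversions) (fun x => A.f x.1 = x.2), h1,
    pow_add, h2.neg_one_pow, mul_one]

theorem signedGF_eq (r : ℕ) : signedGF r = statGF 0 r := by
  classical
  ext n
  rw [signedGF, PowerSeries.coeff_mk, statGF, coeff_gf]
  have hinv : ∀ π ∈ involutions3412 r n, π⁻¹ = π := fun π hπ => by
    rw [involutions3412, Finset.mem_filter] at hπ
    exact hπ.2.1
  refine Finset.sum_bij (fun π hπ => ofPerm π (hinv π hπ)) ?_ ?_ ?_ ?_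
  · intro π hπ
    have h1 := hinv π hπ
    rw [involutions3412, Finset.mem_filter, occurrences_3412 π h1] at hπ
    simp only [Finset.mem_filter, Set.Finite.mem_toFinset]
    exact ⟨rfl, hπ.2.2⟩
  · intro π hπ π' hπ' he
    ext x
    rw [← ofPerm_f π (hinv π hπ), ← ofPerm_f π' (hinv π' hπ'), he]
  · intro A hA
    simp only [Finset.mem_filter, Set.Finite.mem_toFinset] at hA
    obtain ⟨π, hπ, rfl⟩ := A.exists_ofPerm hA.1
    refine ⟨π, ?_, rfl⟩
    rw [involutions3412, Finset.mem_filter, occurrences_3412 π hπ]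
    exact ⟨Finset.mem_univ _, hπ, hA.2⟩
  · intro π hπ
    rw [occurrences_21 π (hinv π hπ), neg_one_pow_card_inversions]
    rfl

end Invol
/-- The series `s` is the formal square root `√(1 - 2x + 5x²)`, the unique one with constant
term `1`. -/
theorem corollary4p3 :
    ∃ s : PowerSeries ℚ,
      PowerSeries.constantCoeff s = 1 ∧
      s ^ 2 = 1 - 2 * PowerSeries.X + 5 * PowerSeries.X ^ 2 ∧
      ∀ r : ℕ, ∃ P Q : MvPolynomial (Fin 2) ℚ,
        MvPolynomial.aeval ![PowerSeries.X, s] Q ≠ 0 ∧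
        MvPolynomial.aeval ![PowerSeries.X, s] Q * signedGF r =
          MvPolynomial.aeval ![PowerSeries.X, s] P := by
  have h := Invol.statGF_zero_zero
  refine ⟨1 - PowerSeries.X + 2 * PowerSeries.X ^ 2 * Invol.statGF 0 0, by simp, ?_, fun r => ?_⟩
  -- Completing the square in the quadratic equation for `statGF 0 0`.
  · linear_combination 4 * PowerSeries.X ^ 2 * h
  · rw [Invol.signedGF_eq]
    exact Invol.statGF_mem rfl 0 r
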